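/- Let $k$ be a field, let $n\ge 2$ be an integer, and let $q\in k$ be a primitive $n$-th root of unity. Let $H_n(q)$ be the Taft algebra: the $k$-algebra generated by $g,h$ subject to $g^n=1$, $h^n=0$, $hg=q\,gh$, with the Hopf algebra structure $$\Delta(g)=g\otimes g,\quad \Delta(h)=1\otimes h+h\otimes g,\quad \varepsilon(g)=1,\quad \varepsilon(h)=0,\quad S(g)=g^{-1},\quad S(h)=-q^{-1}g^{n-1}h.$$ Let $r(H_n(q))$ be its Green ring: the abelian group generated by the isomorphism classes $[V]$ of finite-dimensional left $H_n(q)$-modules modulo the relations $[M\oplus V]=[M]+[V]$, with multiplication $[M][V]=[M\otimes_k V]$, where $H_n(q)$ acts on $M\otimes_k V$ through $\Delta$. Let $S_{-1}$ be the one-dimensional module on which $g$ acts as $q^{-1}$ and $h$ as $0$, and let $M(2,0)$ be the two-dimensional module with basis $v_1,v_2$ and $g v_1=v_1$, $g v_2=q^{-1}v_2$, $h v_1=v_2$, $h v_2=0$. Define $f_m(y,z)\in\mathbb Z[y,z]$ for $m\ge 1$ by $f_1=1$, $f_2=z$ and $f_m=z f_{m-1}-y f_{m-2}$ for $m\ge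 3$, and let $I$ be the ideal of $\mathbb Z[y,z]$ generated by $y^n-1$ and $(z-y-1)f_n(y,z)$. Then there is a ring isomorphism $\mathbb Z[y,z]/I\cong r(H_n(q))$ that sends the class of $y$ to $[S_{-1}]$ and the class of $z$ to $[M(2,0)]$. -/

import Mathlib

open scoped TensorProduct

universe u v

/-! ## Finite-dimensional modules over a bialgebra and the Green ring -/

/-- A finite-dimensional left module over the `k`-algebra `H`. The carriers live in the universe of
`k`, which contains every finite-dimensional module up to isomorphism. -/
structure FDModule (k : Type u) (H : Type v) [Field k] [Ring H] [Algebra k H] where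
  carrier : Type u
  [addCommGroup : AddCommGroup carrier]
  [moduleBase : Module k carrier]
  [module : Module H carrier]
  [isScalarTower : IsScalarTower k H carrier]
  [finite : Module.Finite k carrier]

namespace FDModule

attribute [instance] addCommGroup moduleBase module isScalarTower finite

section Algebra

variable {k : Type u} {H : Type v} [Field k] [Ring H] [Algebra k H]

/-- The `H`-module on a finite-dimensional vector space given by an algebra map
`H → End_k(V)`. -/
def ofAction (V : Type u) [AddCommGroup V] [Module k V] [Module.Finite k V]
    (ρ : H →ₐ[k] Module.End k V) : FDModule k H :=
  letI : Module H V := Module.compHom V ρ.toRingHom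
  { carrier := V
    isScalarTower := ⟨fun c a v => by
      change ρ (c • a) v = c • ρ a v
      rw [map_smul, LinearMap.smul_apply]⟩ }

/-- The algebra map `H → End_k(V)` given by the action. -/
def action (V : FDModule k H) : H →ₐ[k] Module.End k V.carrier :=
  Algebra.lsmul k k V.carrier

/-- Isomorphism of `H`-modules. -/
instance isoSetoid : Setoid (FDModule k H) where
  r V W := Nonempty (V.carrier ≃ₗ[H] W.carrier)
  iseqv := ⟨fun V => ⟨LinearEquiv.refl H V.carrier⟩, fun ⟨e⟩ => ⟨e.symm⟩,
    fun ⟨e⟩ ⟨f⟩ => ⟨e.trans f⟩⟩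

/-- Direct sum of modules. -/
def directSum (V W : FDModule k H) : FDModule k H where
  carrier := V.carrier × W.carrier

/-- A `k`-linear equivalence that commutes with the actions gives an isomorphism. -/
theorem equiv_of_linearEquiv {V W : FDModule k H} (e : V.carrier ≃ₗ[k] W.carrier)
    (he : ∀ a : H, e.toLinearMap ∘ₗ V.action a = W.action a ∘ₗ e.toLinearMap) : V ≈ W :=
  ⟨{ e with map_smul' := fun a v => LinearMap.congr_fun (he a) v }⟩

/-- The `k`-linear equivalence underlying an isomorphism of modules. -/
def baseEquiv {V W : FDModule k H} (e : V.carrier ≃ₗ[H] W.carrier) :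
    V.carrier ≃ₗ[k] W.carrier :=
  { e with
    map_smul' := fun c v => by
      change e (c • v) = c • e v
      rw [← algebraMap_smul H c v, map_smul, algebraMap_smul] }

theorem baseEquiv_action {V W : FDModule k H} (e : V.carrier ≃ₗ[H] W.carrier) (a : H) :
    (baseEquiv e).toLinearMap ∘ₗ V.action a = W.action a ∘ₗ (baseEquiv e).toLinearMap :=
  LinearMap.ext fun v => e.map_smul a v

end Algebra

section Bialgebra

variable {k : Type u} {H : Type v} [Field k] [Ring H] [Bialgebra k H]

/-- The action of `H` on `V ⊗ W` through the comultiplication: if `Δ(a) = ∑ a₁ ⊗ a₂`, then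
`a • (v ⊗ w) = ∑ (a₁ • v) ⊗ (a₂ • w)`. -/
noncomputable def tensorAction (V W : FDModule k H) :
    H →ₐ[k] Module.End k (V.carrier ⊗[k] W.carrier) :=
  (Module.endTensorEndAlgHom (R := k) (S := k) (A := k)).comp
    ((Algebra.TensorProduct.map V.action W.action).comp (Bialgebra.comulAlgHom k H))

/-- The tensor product over `k` of two `H`-modules. -/
noncomputable def tensor (V W : FDModule k H) : FDModule k H :=
  ofAction (V.carrier ⊗[k] W.carrier) (tensorAction V W)

/-- The trivial one-dimensional module, on which `H` acts through the counit. -/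
noncomputable def trivial (k : Type u) (H : Type v) [Field k] [Ring H] [Bialgebra k H] :
    FDModule k H :=
  ofAction k ((Algebra.lmul k k).comp (Bialgebra.counitAlgHom k H))

/-- The orbit map `a ↦ a • v`. -/
def orbit (V : FDModule k H) (v : V.carrier) : H →ₗ[k] V.carrier :=
  V.action.toLinearMap.flip v

theorem tensorAction_tmul (V W : FDModule k H) (v : V.carrier) (w : W.carrier) (a : H) :
    tensorAction V W a (v ⊗ₜ[k] w) =
      TensorProduct.map (V.orbit v) (W.orbit w) (Coalgebra.comul a) := by
  change Module.endTensorEndAlgHom (R := k) (S := k) (A := k)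
    (Algebra.TensorProduct.map V.action W.action (Coalgebra.comul a)) (v ⊗ₜ[k] w) = _
  generalize (Coalgebra.comul (R := k) a : H ⊗[k] H) = t
  induction t with
  | zero => simp
  | add x y hx hy => simp only [map_add, LinearMap.add_apply, hx, hy]
  | tmul x y => rfl

theorem orbit_tensor (V W : FDModule k H) (v : V.carrier) (w : W.carrier) :
    (tensor V W).orbit (v ⊗ₜ[k] w : V.carrier ⊗[k] W.carrier) =
      TensorProduct.map (V.orbit v) (W.orbit w) ∘ₗ Coalgebra.comul :=
  LinearMap.ext fun a => tensorAction_tmul V W v w a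

/-- Two modules are isomorphic once a `k`-linear equivalence carries orbit maps to orbit maps, for
vectors from a spanning set. -/
theorem equiv_of_orbit {V W : FDModule k H} (e : V.carrier ≃ₗ[k] W.carrier)
    (s : Set V.carrier) (hs : Submodule.span k s = ⊤)
    (he : ∀ v ∈ s, e.toLinearMap ∘ₗ V.orbit v = W.orbit (e v)) : V ≈ W :=
  equiv_of_linearEquiv e fun a => LinearMap.ext_on hs fun v hv => LinearMap.congr_fun (he v hv) a

theorem tensor_congr {V V' W W' : FDModule k H} (h : V ≈ V') (h' : W ≈ W') :
    tensor V W ≈ tensor V' W' := by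
  obtain ⟨e⟩ := h
  obtain ⟨f⟩ := h'
  refine equiv_of_orbit (V := tensor V W) (W := tensor V' W')
    (TensorProduct.congr (baseEquiv e) (baseEquiv f)) _
    (TensorProduct.span_tmul_eq_top k V.carrier W.carrier) ?_
  rintro _ ⟨v, w, rfl⟩
  have he : V'.orbit (baseEquiv e v) = (baseEquiv e).toLinearMap ∘ₗ V.orbit v :=
    LinearMap.ext fun a => (e.map_smul a v).symm
  have hf : W'.orbit (baseEquiv f w) = (baseEquiv f).toLinearMap ∘ₗ W.orbit w :=
    LinearMap.ext fun a => (f.map_smul a w).symm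
  refine Eq.trans ?_ (orbit_tensor V' W' (baseEquiv e v) (baseEquiv f w)).symm
  refine (congrArg _ (orbit_tensor V W v w)).trans ?_
  rw [he, hf, TensorProduct.map_comp]
  rfl

theorem tensor_assoc (V W X : FDModule k H) :
    tensor (tensor V W) X ≈ tensor V (tensor W X) := by
  refine equiv_of_linearEquiv (V := tensor (tensor V W) X) (W := tensor V (tensor W X))
    (TensorProduct.assoc k V.carrier W.carrier X.carrier) fun a => ?_
  refine TensorProduct.ext_threefold fun v w x => ?_
  have h1 : (tensor (tensor V W) X).orbit
      ((v ⊗ₜ[k] w) ⊗ₜ[k] x : (V.carrier ⊗[k] W.carrier) ⊗[k] X.carrier) =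
      TensorProduct.map (TensorProduct.map (V.orbit v) (W.orbit w) ∘ₗ Coalgebra.comul)
        (X.orbit x) ∘ₗ Coalgebra.comul := by
    rw [← orbit_tensor]
    exact orbit_tensor (tensor V W) X _ x
  have h2 : (tensor V (tensor W X)).orbit
      (v ⊗ₜ[k] (w ⊗ₜ[k] x) : V.carrier ⊗[k] (W.carrier ⊗[k] X.carrier)) =
      TensorProduct.map (V.orbit v)
        (TensorProduct.map (W.orbit w) (X.orbit x) ∘ₗ Coalgebra.comul) ∘ₗ Coalgebra.comul := by
    rw [← orbit_tensor]
    exact orbit_tensor V (tensor W X) v _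
  change TensorProduct.assoc k V.carrier W.carrier X.carrier
    ((tensor (tensor V W) X).orbit _ a) = (tensor V (tensor W X)).orbit _ a
  have h3 := Coalgebra.coassoc_apply (R := k) a
  have h4 : ∀ t : H ⊗[k] H, TensorProduct.map (V.orbit v)
      (TensorProduct.map (W.orbit w) (X.orbit x) ∘ₗ Coalgebra.comul) t =
      TensorProduct.map (V.orbit v) (TensorProduct.map (W.orbit w) (X.orbit x))
        (Coalgebra.comul.lTensor H t) := fun t => by
    rw [← LinearMap.comp_apply, LinearMap.map_comp_lTensor]
  have h5 : ∀ t : H ⊗[k] H, TensorProduct.map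
      (TensorProduct.map (V.orbit v) (W.orbit w) ∘ₗ Coalgebra.comul) (X.orbit x) t =
      TensorProduct.map (TensorProduct.map (V.orbit v) (W.orbit w)) (X.orbit x)
        (Coalgebra.comul.rTensor H t) := fun t => by
    rw [← LinearMap.comp_apply, LinearMap.map_comp_rTensor]
  have key : TensorProduct.assoc k V.carrier W.carrier X.carrier
      (TensorProduct.map (TensorProduct.map (V.orbit v) (W.orbit w) ∘ₗ Coalgebra.comul)
        (X.orbit x) (Coalgebra.comul a)) =
      TensorProduct.map (V.orbit v)
        (TensorProduct.map (W.orbit w) (X.orbit x) ∘ₗ Coalgebra.comul) (Coalgebra.comul a) := by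
    rw [h4, h5, ← h3]
    exact (TensorProduct.map_map_assoc _ _ _ _).symm
  exact (congrArg (TensorProduct.assoc k V.carrier W.carrier X.carrier)
    (LinearMap.congr_fun h1 a)).trans (key.trans (LinearMap.congr_fun h2 a).symm)

theorem trivial_tensor (V : FDModule k H) : tensor (trivial k H) V ≈ V := by
  refine equiv_of_orbit (V := tensor (trivial k H) V) (W := V)
    (TensorProduct.lid k V.carrier) _ (TensorProduct.span_tmul_eq_top k k V.carrier) ?_
  rintro _ ⟨c, v, rfl⟩
  refine (congrArg _ (orbit_tensor (trivial k H) V c v)).trans ?_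
  have h : (trivial k H).orbit c = (LinearMap.mulRight k c) ∘ₗ Coalgebra.counit (A := H) := rfl
  rw [h]
  refine LinearMap.ext fun a => ?_
  have h1 : TensorProduct.map (LinearMap.mulRight k c ∘ₗ Coalgebra.counit (A := H)) (V.orbit v) =
    TensorProduct.map (LinearMap.mulRight k c) (V.orbit v) ∘ₗ
      Coalgebra.counit.rTensor H := by rw [LinearMap.map_comp_rTensor]
  change TensorProduct.lid k V.carrier (TensorProduct.map
    (LinearMap.mulRight k c ∘ₗ Coalgebra.counit) (V.orbit v) (Coalgebra.comul a)) =
      V.action a (c • v)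
  rw [h1, LinearMap.comp_apply, Coalgebra.rTensor_counit_comul]
  simp [orbit]

theorem tensor_trivial (V : FDModule k H) : tensor V (trivial k H) ≈ V := by
  refine equiv_of_orbit (V := tensor V (trivial k H)) (W := V)
    (TensorProduct.rid k V.carrier) _ (TensorProduct.span_tmul_eq_top k V.carrier k) ?_
  rintro _ ⟨v, c, rfl⟩
  refine (congrArg _ (orbit_tensor V (trivial k H) v c)).trans ?_
  have h : (trivial k H).orbit c = (LinearMap.mulRight k c) ∘ₗ Coalgebra.counit (A := H) := rfl
  rw [h]
  refine LinearMap.ext fun a => ?_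
  have h1 : TensorProduct.map (V.orbit v) (LinearMap.mulRight k c ∘ₗ Coalgebra.counit (A := H)) =
    TensorProduct.map (V.orbit v) (LinearMap.mulRight k c) ∘ₗ
      Coalgebra.counit.lTensor H := by rw [LinearMap.map_comp_lTensor]
  change TensorProduct.rid k V.carrier (TensorProduct.map (V.orbit v)
    (LinearMap.mulRight k c ∘ₗ Coalgebra.counit) (Coalgebra.comul a)) =
      V.action a (c • v)
  rw [h1, LinearMap.comp_apply, Coalgebra.lTensor_counit_comul]
  simp [orbit]

theorem directSum_tensor (V W X : FDModule k H) :
    tensor (directSum V W) X ≈ directSum (tensor V X) (tensor W X) := by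
  refine equiv_of_orbit (V := tensor (directSum V W) X) (W := directSum (tensor V X) (tensor W X))
    (TensorProduct.prodLeft k k V.carrier W.carrier X.carrier) _
    (TensorProduct.span_tmul_eq_top k (V.carrier × W.carrier) X.carrier) ?_
  rintro _ ⟨⟨v, w⟩, x, rfl⟩
  refine (congrArg _ (orbit_tensor (directSum V W) X (v, w) x)).trans ?_
  refine LinearMap.ext fun a => ?_
  refine Eq.trans ?_ (congrArg₂ Prod.mk (LinearMap.congr_fun (orbit_tensor V X v x) a)
    (LinearMap.congr_fun (orbit_tensor W X w x) a)).symm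
  change TensorProduct.prodLeft k k V.carrier W.carrier X.carrier
    (TensorProduct.map ((V.orbit v).prod (W.orbit w)) (X.orbit x) (Coalgebra.comul a)) =
    (TensorProduct.map (V.orbit v) (X.orbit x) (Coalgebra.comul a),
      TensorProduct.map (W.orbit w) (X.orbit x) (Coalgebra.comul a))
  generalize (Coalgebra.comul (R := k) a : H ⊗[k] H) = t
  induction t with
  | zero => simp only [map_zero]; rfl
  | add x y hx hy => simp only [map_add, hx, hy, Prod.mk_add_mk]
  | tmul x y => simp

theorem tensor_directSum (V W X : FDModule k H) :
    tensor V (directSum W X) ≈ directSum (tensor V W) (tensor V X) := by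
  refine equiv_of_orbit (V := tensor V (directSum W X)) (W := directSum (tensor V W) (tensor V X))
    (TensorProduct.prodRight k k V.carrier W.carrier X.carrier) _
    (TensorProduct.span_tmul_eq_top k V.carrier (W.carrier × X.carrier)) ?_
  rintro _ ⟨v, ⟨w, x⟩, rfl⟩
  refine (congrArg _ (orbit_tensor V (directSum W X) v (w, x))).trans ?_
  refine LinearMap.ext fun a => ?_
  refine Eq.trans ?_ (congrArg₂ Prod.mk (LinearMap.congr_fun (orbit_tensor V W v w) a)
    (LinearMap.congr_fun (orbit_tensor V X v x) a)).symm
  change TensorProduct.prodRight k k V.carrier W.carrier X.carrier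
    (TensorProduct.map (V.orbit v) ((W.orbit w).prod (X.orbit x)) (Coalgebra.comul a)) =
    (TensorProduct.map (V.orbit v) (W.orbit w) (Coalgebra.comul a),
      TensorProduct.map (V.orbit v) (X.orbit x) (Coalgebra.comul a))
  generalize (Coalgebra.comul (R := k) a : H ⊗[k] H) = t
  induction t with
  | zero => simp only [map_zero]; rfl
  | add x y hx hy => simp only [map_add, hx, hy, Prod.mk_add_mk]
  | tmul x y => simp

end Bialgebra

end FDModule

section GreenRing

variable (k : Type u) (H : Type v) [Field k] [Ring H] [Bialgebra k H]

/-- The set of isomorphism classes of finite-dimensional `H`-modules. -/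
def IsoClass : Type (max (u + 1) v) := Quotient (FDModule.isoSetoid (k := k) (H := H))

/-- Isomorphism classes form a monoid under the tensor product. -/
noncomputable instance IsoClass.monoid : Monoid (IsoClass k H) where
  mul := Quotient.map₂ FDModule.tensor fun _ _ h _ _ h' => FDModule.tensor_congr h h'
  one := Quotient.mk _ (FDModule.trivial k H)
  mul_assoc := by
    rintro ⟨V⟩ ⟨W⟩ ⟨X⟩
    exact Quotient.sound (FDModule.tensor_assoc V W X)
  one_mul := by
    rintro ⟨V⟩
    exact Quotient.sound (FDModule.trivial_tensor V)
  mul_one := by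
    rintro ⟨V⟩
    exact Quotient.sound (FDModule.tensor_trivial V)

variable {k H} in
/-- The isomorphism class of `V`, as a generator of the free abelian group on all classes. -/
def FDModule.freeClass (V : FDModule k H) : FreeAbelianGroup (IsoClass k H) :=
  FreeAbelianGroup.of (Quotient.mk _ V)

variable {k H} in
theorem FDModule.freeClass_mul (V W : FDModule k H) :
    V.freeClass * W.freeClass = (V.tensor W).freeClass :=
  FreeAbelianGroup.of_mul_of _ _

variable {k H} in
theorem FDModule.freeClass_eq {V W : FDModule k H} (h : V ≈ W) : V.freeClass = W.freeClass :=
  congrArg FreeAbelianGroup.of (Quotient.sound h)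

/-- The subgroup generated by all `[M ⊕ V] - [M] - [V]`. -/
noncomputable def greenSubgroup : AddSubgroup (FreeAbelianGroup (IsoClass k H)) :=
  AddSubgroup.closure
    {x | ∃ M V : FDModule k H, x = (M.directSum V).freeClass - (M.freeClass + V.freeClass)}

theorem greenSubgroup_mul_left (a x : FreeAbelianGroup (IsoClass k H))
    (hx : x ∈ greenSubgroup k H) : a * x ∈ greenSubgroup k H := by
  induction a using FreeAbelianGroup.induction_on with
  | zero => rw [zero_mul]; exact zero_mem _
  | of c =>
    obtain ⟨U, rfl⟩ := Quotient.exists_rep c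
    induction hx using AddSubgroup.closure_induction with
    | mem x hx =>
      obtain ⟨M, V, rfl⟩ := hx
      refine AddSubgroup.subset_closure ⟨U.tensor M, U.tensor V, ?_⟩
      change U.freeClass * _ = _
      rw [mul_sub, mul_add, FDModule.freeClass_mul, FDModule.freeClass_mul,
        FDModule.freeClass_mul, FDModule.freeClass_eq (FDModule.tensor_directSum U M V)]
    | zero => rw [mul_zero]; exact zero_mem _
    | add x y _ _ hx hy => rw [mul_add]; exact add_mem hx hy
    | neg x _ hx => rw [mul_neg]; exact neg_mem hx
  | neg c hc => rw [neg_mul]; exact neg_mem hc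
  | add a b ha hb => rw [add_mul]; exact add_mem ha hb

theorem greenSubgroup_mul_right (a x : FreeAbelianGroup (IsoClass k H))
    (hx : x ∈ greenSubgroup k H) : x * a ∈ greenSubgroup k H := by
  induction a using FreeAbelianGroup.induction_on with
  | zero => rw [mul_zero]; exact zero_mem _
  | of c =>
    obtain ⟨U, rfl⟩ := Quotient.exists_rep c
    induction hx using AddSubgroup.closure_induction with
    | mem x hx =>
      obtain ⟨M, V, rfl⟩ := hx
      refine AddSubgroup.subset_closure ⟨M.tensor U, V.tensor U, ?_⟩
      change _ * U.freeClass = _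
      rw [sub_mul, add_mul, FDModule.freeClass_mul, FDModule.freeClass_mul,
        FDModule.freeClass_mul, FDModule.freeClass_eq (FDModule.directSum_tensor M V U)]
    | zero => rw [zero_mul]; exact zero_mem _
    | add x y _ _ hx hy => rw [add_mul]; exact add_mem hx hy
    | neg x _ hx => rw [neg_mul]; exact neg_mem hx
  | neg c hc => rw [mul_neg]; exact neg_mem hc
  | add a b ha hb => rw [mul_add]; exact add_mem ha hb

/-- The subgroup of relations, which is a two-sided ideal of the monoid ring of isomorphism
classes. -/
noncomputable def greenIdeal : Ideal (FreeAbelianGroup (IsoClass k H)) where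
  carrier := greenSubgroup k H
  add_mem' := add_mem
  zero_mem' := zero_mem _
  smul_mem' := greenSubgroup_mul_left k H

instance greenIdeal_isTwoSided : (greenIdeal k H).IsTwoSided :=
  ⟨fun b hx => greenSubgroup_mul_right k H b _ hx⟩

/-- The Green ring (representation ring) `r(H)`: the abelian group generated by the isomorphism
classes `[V]` of finite-dimensional `H`-modules modulo `[M ⊕ V] = [M] + [V]`, with the
multiplication `[M][V] = [M ⊗ V]`. -/
noncomputable def GreenRing : Type (max (u + 1) v) := FreeAbelianGroup (IsoClass k H) ⧸ greenIdeal k H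

noncomputable instance GreenRing.ring : Ring (GreenRing k H) :=
  inferInstanceAs (Ring (FreeAbelianGroup (IsoClass k H) ⧸ greenIdeal k H))

variable {k H} in
/-- The class `[V]` in the Green ring. -/
noncomputable def FDModule.greenClass (V : FDModule k H) : GreenRing k H :=
  Ideal.Quotient.mk (greenIdeal k H) V.freeClass

end GreenRing

/-! ## A vanishing lemma for `q`-commuting nilpotent elements -/

section QBinomial

variable {k : Type u} [Field k]

/-- The `q`-binomial coefficients. -/
def qBinom (q : k) : ℕ → ℕ → k
  | _, 0 => 1
  | 0, _ + 1 => 0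
  | m + 1, i + 1 => q ^ (i + 1) * qBinom q m (i + 1) + qBinom q m i

theorem qBinom_zero_right (q : k) (m : ℕ) : qBinom q m 0 = 1 := by cases m <;> rfl

theorem qBinom_succ_succ (q : k) (m i : ℕ) :
    qBinom q (m + 1) (i + 1) = q ^ (i + 1) * qBinom q m (i + 1) + qBinom q m i := rfl

theorem qBinom_eq_zero_of_lt (q : k) : ∀ m i : ℕ, m < i → qBinom q m i = 0
  | _, 0, h => absurd h (Nat.not_lt_zero _)
  | 0, _ + 1, _ => rfl
  | m + 1, i + 1, h => by
    rw [qBinom_succ_succ, qBinom_eq_zero_of_lt q m _ (by omega),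
      qBinom_eq_zero_of_lt q m _ (by omega), mul_zero, add_zero]

theorem qBinom_step (q : k) (m : ℕ) : ∀ i j : ℕ, i + j = m →
    (1 - q ^ (i + 1)) * qBinom q m (i + 1) = (1 - q ^ j) * qBinom q m i := by
  induction m with
  | zero =>
    intro i j h
    obtain ⟨rfl, rfl⟩ : i = 0 ∧ j = 0 := by omega
    simp [qBinom]
  | succ m ih =>
    intro i j h
    rcases j with _ | j
    · rw [qBinom_eq_zero_of_lt q _ _ (by omega)]
      simp
    have h1 := ih i j (by omega)
    rcases i with _ | i
    · have hj : j = m := by omega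
      subst hj
      rw [qBinom_succ_succ, qBinom_zero_right, qBinom_zero_right]
      rw [qBinom_zero_right] at h1
      linear_combination q * h1
    · have h2 := ih i (j + 1) (by omega)
      rw [qBinom_succ_succ, qBinom_succ_succ q m i]
      linear_combination q ^ (i + 2) * h1 + h2

theorem qBinom_primitive {q : k} {n : ℕ} (hq : IsPrimitiveRoot q n) (i : ℕ) (h0 : 0 < i)
    (hi : i < n) : qBinom q n i = 0 := by
  obtain ⟨i, rfl⟩ := Nat.exists_eq_succ_of_ne_zero h0.ne'
  obtain ⟨m, rfl⟩ := Nat.exists_eq_succ_of_ne_zero (by omega : n ≠ 0)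
  have h1 := qBinom_step q m i (m - i) (by omega)
  have h2 : (1 - q ^ (i + 1)) * qBinom q (m + 1) (i + 1) = 0 := by
    have h3 : q ^ (i + 1) * q ^ (m - i) = 1 := by
      rw [← pow_add, show i + 1 + (m - i) = m + 1 by omega]; exact hq.pow_eq_one
    rw [qBinom_succ_succ]
    linear_combination q ^ (i + 1) * h1 - qBinom q m i * h3
  refine (mul_eq_zero.1 h2).resolve_left fun h => ?_
  exact hq.pow_ne_one_of_pos_of_lt (Nat.succ_ne_zero i) hi (sub_eq_zero.1 h).symm

variable {A : Type v} [Ring A] [Algebra k A]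

theorem mul_pow_of_qComm {q : k} {x y : A} (h : x * y = q • (y * x)) (m : ℕ) :
    x * y ^ m = q ^ m • (y ^ m * x) := by
  induction m with
  | zero => simp
  | succ m ih =>
    rw [pow_succ, ← mul_assoc, ih, smul_mul_assoc, mul_assoc, h, mul_smul_comm, smul_smul,
      mul_assoc, ← pow_succ]

theorem add_pow_of_qComm {q : k} {x y : A} (h : x * y = q • (y * x)) (m : ℕ) :
    (x + y) ^ m = ∑ i ∈ Finset.range (m + 1), qBinom q m i • (y ^ i * x ^ (m - i)) := by
  induction m with
  | zero => simp [qBinom]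
  | succ m ih =>
    rw [pow_succ', ih, add_mul, Finset.mul_sum, Finset.mul_sum, Finset.sum_range_succ' _ (m + 1)]
    simp only [qBinom_succ_succ, add_smul, Finset.sum_add_distrib]
    have e1 : ∑ i ∈ Finset.range (m + 1), x * qBinom q m i • (y ^ i * x ^ (m - i)) =
        ∑ i ∈ Finset.range (m + 1 + 1), (q ^ i * qBinom q m i) • (y ^ i * x ^ (m + 1 - i)) := by
      rw [Finset.sum_range_succ _ (m + 1), qBinom_eq_zero_of_lt q m (m + 1) (by omega), mul_zero,
        zero_smul, add_zero]
      refine Finset.sum_congr rfl fun i hi => ?_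
      have hi' := Finset.mem_range.1 hi
      rw [mul_smul_comm, ← mul_assoc, mul_pow_of_qComm h, smul_mul_assoc, smul_smul, mul_assoc,
        ← pow_succ', mul_comm (qBinom q m i), show m - i + 1 = m + 1 - i by omega]
    have e2 : ∑ i ∈ Finset.range (m + 1), y * qBinom q m i • (y ^ i * x ^ (m - i)) =
        ∑ i ∈ Finset.range (m + 1), qBinom q m i • (y ^ (i + 1) * x ^ (m + 1 - (i + 1))) := by
      refine Finset.sum_congr rfl fun i hi => ?_
      rw [mul_smul_comm, ← mul_assoc, ← pow_succ', Nat.add_sub_add_right]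
    rw [e1, e2, Finset.sum_range_succ' _ (m + 1)]
    simp only [qBinom_zero_right, pow_zero, mul_one, one_mul]
    abel

theorem add_pow_eq_zero_of_qComm {q : k} {n : ℕ} (hq : IsPrimitiveRoot q n) {x y : A}
    (h : x * y = q • (y * x)) (hx : x ^ n = 0) (hy : y ^ n = 0) : (x + y) ^ n = 0 := by
  rw [add_pow_of_qComm h]
  refine Finset.sum_eq_zero fun i hi => ?_
  have hi' := Finset.mem_range.1 hi
  rcases Nat.eq_zero_or_pos i with rfl | h0
  · rw [Nat.sub_zero, hx, mul_zero, smul_zero]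
  rcases Nat.lt_or_ge i n with h1 | h1
  · rw [qBinom_primitive hq i h0 h1, zero_smul]
  · rw [show i = n by omega, hy, zero_mul, smul_zero]

theorem mul_pow_eq_zero_of_qComm {r : k} {x y : A} (h : x * y = r • (y * x)) {n : ℕ}
    (hx : x ^ n = 0) : (y * x) ^ n = 0 := by
  have key : ∀ m : ℕ, ∃ c : k, (y * x) ^ m = c • (y ^ m * x ^ m) := by
    intro m
    induction m with
    | zero => exact ⟨1, by simp⟩
    | succ m ih =>
      obtain ⟨c, hc⟩ := ih
      refine ⟨r ^ m * c, ?_⟩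
      rw [pow_succ', hc, mul_smul_comm, mul_assoc, ← mul_assoc x, mul_pow_of_qComm h,
        smul_mul_assoc, mul_smul_comm, smul_smul, mul_comm c, mul_assoc (y ^ m), ← pow_succ',
        ← mul_assoc, ← pow_succ']
  obtain ⟨c, hc⟩ := key n
  rw [hc, hx, mul_zero, smul_zero]

end QBinomial

/-! ## The Taft algebra -/

/-- The two generators of the Taft algebra. -/
inductive TaftGen : Type
  | g
  | h

/-- The defining relations `g ^ n = 1`, `h ^ n = 0`, `h g = q g h`. -/
inductive TaftRel {k : Type u} [Field k] (n : ℕ) (q : k) :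
    FreeAlgebra k TaftGen → FreeAlgebra k TaftGen → Prop
  | g_pow : TaftRel n q (FreeAlgebra.ι k TaftGen.g ^ n) 1
  | h_pow : TaftRel n q (FreeAlgebra.ι k TaftGen.h ^ n) 0
  | h_mul_g : TaftRel n q (FreeAlgebra.ι k TaftGen.h * FreeAlgebra.ι k TaftGen.g)
      (q • (FreeAlgebra.ι k TaftGen.g * FreeAlgebra.ι k TaftGen.h))

/-- The Taft algebra `H_n(q)` over `k`, for `n ≥ 2` and a primitive `n`-th root of unity `q` in `k`:
the `k`-algebra on generators `g`, `h` with the relations `g ^ n = 1`, `h ^ n = 0`, `h g = q g h`.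
The two proofs do not enter the algebra; they are arguments because the Hopf algebra structure below
needs them. -/
def TaftAlgebra {k : Type u} [Field k] {n : ℕ} (_hn : 2 ≤ n) {q : k}
    (_hq : IsPrimitiveRoot q n) : Type u :=
  RingQuot (TaftRel n q)

namespace TaftAlgebra

variable {k : Type u} [Field k] {n : ℕ} (hn : 2 ≤ n) {q : k} (hq : IsPrimitiveRoot q n)

instance ring : Ring (TaftAlgebra hn hq) := inferInstanceAs (Ring (RingQuot (TaftRel n q)))

instance algebra : Algebra k (TaftAlgebra hn hq) :=
  inferInstanceAs (Algebra k (RingQuot (TaftRel n q)))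

/-- The quotient map from the free algebra. -/
def mk : FreeAlgebra k TaftGen →ₐ[k] TaftAlgebra hn hq := RingQuot.mkAlgHom k (TaftRel n q)

/-- The generator `g`. -/
def g : TaftAlgebra hn hq := mk hn hq (FreeAlgebra.ι k TaftGen.g)

/-- The generator `h`. -/
def h : TaftAlgebra hn hq := mk hn hq (FreeAlgebra.ι k TaftGen.h)

theorem g_pow : g hn hq ^ n = 1 := by
  have := RingQuot.mkAlgHom_rel k (TaftRel.g_pow (n := n) (q := q))
  rw [map_pow, map_one] at this
  exact this

theorem h_pow : h hn hq ^ n = 0 := by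
  have := RingQuot.mkAlgHom_rel k (TaftRel.h_pow (n := n) (q := q))
  rw [map_pow, map_zero] at this
  exact this

theorem h_mul_g : h hn hq * g hn hq = q • (g hn hq * h hn hq) := by
  have := RingQuot.mkAlgHom_rel k (TaftRel.h_mul_g (n := n) (q := q))
  rw [map_smul, map_mul, map_mul] at this
  exact this

section Lift

variable {A : Type v} [Ring A] [Algebra k A]

/-- The algebra map out of the Taft algebra given by the images of `g` and `h`. -/
def lift (a b : A) (ha : a ^ n = 1) (hb : b ^ n = 0) (hab : b * a = q • (a * b)) :
    TaftAlgebra hn hq →ₐ[k] A :=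
  RingQuot.liftAlgHom k
    ⟨FreeAlgebra.lift k (fun t => match t with
      | TaftGen.g => a
      | TaftGen.h => b), by
      rintro _ _ (_ | _ | _)
      · simpa using ha
      · simpa using hb
      · simpa using hab⟩

theorem lift_g (a b : A) (ha : a ^ n = 1) (hb : b ^ n = 0) (hab : b * a = q • (a * b)) :
    lift hn hq a b ha hb hab (g hn hq) = a :=
  (RingQuot.liftAlgHom_mkAlgHom_apply k _ _ _).trans (FreeAlgebra.lift_ι_apply _ _)

theorem lift_h (a b : A) (ha : a ^ n = 1) (hb : b ^ n = 0) (hab : b * a = q • (a * b)) :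
    lift hn hq a b ha hb hab (h hn hq) = b :=
  (RingQuot.liftAlgHom_mkAlgHom_apply k _ _ _).trans (FreeAlgebra.lift_ι_apply _ _)

theorem algHom_ext {φ ψ : TaftAlgebra hn hq →ₐ[k] A} (hg : φ (g hn hq) = ψ (g hn hq))
    (hh : φ (h hn hq) = ψ (h hn hq)) : φ = ψ := by
  refine RingQuot.ringQuot_ext' k _ _ (FreeAlgebra.hom_ext (funext fun t => ?_))
  cases t
  · exact hg
  · exact hh

end Lift

theorem induction {P : TaftAlgebra hn hq → Prop} (hg : P (g hn hq)) (hh : P (h hn hq))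
    (hc : ∀ c : k, P (algebraMap k _ c)) (hadd : ∀ a b, P a → P b → P (a + b))
    (hmul : ∀ a b, P a → P b → P (a * b)) (a : TaftAlgebra hn hq) : P a := by
  obtain ⟨x, rfl⟩ := RingQuot.mkAlgHom_surjective k (TaftRel n q) a
  change P (mk hn hq x)
  induction x using FreeAlgebra.induction with
  | grade0 c => rw [AlgHom.commutes]; exact hc c
  | grade1 t => cases t; exacts [hg, hh]
  | mul a b ha hb => rw [map_mul]; exact hmul _ _ ha hb
  | add a b ha hb => rw [map_add]; exact hadd _ _ ha hb

/-- The counit: `ε(g) = 1`, `ε(h) = 0`. -/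
def counit : TaftAlgebra hn hq →ₐ[k] k :=
  lift hn hq 1 0 (one_pow n) (zero_pow (by omega)) (by simp)

/-- The comultiplication: `Δ(g) = g ⊗ g`, `Δ(h) = 1 ⊗ h + h ⊗ g`. -/
noncomputable def comul :
    TaftAlgebra hn hq →ₐ[k] TaftAlgebra hn hq ⊗[k] TaftAlgebra hn hq :=
  lift hn hq (g hn hq ⊗ₜ g hn hq) (1 ⊗ₜ h hn hq + h hn hq ⊗ₜ g hn hq)
    (by rw [Algebra.TensorProduct.tmul_pow, g_pow]; rfl)
    (by
      refine add_pow_eq_zero_of_qComm hq ?_ ?_ ?_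
      · rw [Algebra.TensorProduct.tmul_mul_tmul, Algebra.TensorProduct.tmul_mul_tmul, h_mul_g,
          one_mul, mul_one, TensorProduct.tmul_smul]
      · rw [Algebra.TensorProduct.tmul_pow, h_pow, TensorProduct.tmul_zero]
      · rw [Algebra.TensorProduct.tmul_pow, h_pow, TensorProduct.zero_tmul])
    (by
      rw [add_mul, mul_add, Algebra.TensorProduct.tmul_mul_tmul,
        Algebra.TensorProduct.tmul_mul_tmul, Algebra.TensorProduct.tmul_mul_tmul,
        Algebra.TensorProduct.tmul_mul_tmul, h_mul_g, one_mul, mul_one, TensorProduct.tmul_smul,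
        smul_add]
      rfl)

theorem counit_g : counit hn hq (g hn hq) = 1 := lift_g ..

theorem counit_h : counit hn hq (h hn hq) = 0 := lift_h ..

theorem comul_g : comul hn hq (g hn hq) = g hn hq ⊗ₜ g hn hq := lift_g ..

theorem comul_h : comul hn hq (h hn hq) = 1 ⊗ₜ h hn hq + h hn hq ⊗ₜ g hn hq := lift_h ..

noncomputable instance bialgebra : Bialgebra k (TaftAlgebra hn hq) :=
  Bialgebra.ofAlgHom (comul hn hq) (counit hn hq)
    (by
      refine algHom_ext hn hq ?_ ?_
      · simp [comul_g]
      · simp [comul_h, comul_g, TensorProduct.add_tmul, TensorProduct.tmul_add,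
          Algebra.TensorProduct.one_def, add_assoc])
    (by
      refine algHom_ext hn hq ?_ ?_
      · simp [comul_g, counit_g]
      · simp [comul_h, counit_h])
    (by
      refine algHom_ext hn hq ?_ ?_
      · simp [comul_g, counit_g]
      · simp [comul_h, counit_h, counit_g])

theorem h_mul_g_pow (m : ℕ) : h hn hq * g hn hq ^ m = q ^ m • (g hn hq ^ m * h hn hq) :=
  mul_pow_of_qComm (h_mul_g hn hq) m

theorem g_mul_g_pow : g hn hq * g hn hq ^ (n - 1) = 1 := by
  rw [← pow_succ', Nat.sub_add_cancel (by omega), g_pow]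

theorem g_pow_mul_g : g hn hq ^ (n - 1) * g hn hq = 1 := by
  rw [← pow_succ, Nat.sub_add_cancel (by omega), g_pow]

theorem q_mul_q_pow (hn : 2 ≤ n) (hq : IsPrimitiveRoot q n) : q * q ^ (n - 1) = 1 := by
  rw [← pow_succ', Nat.sub_add_cancel (by omega), hq.pow_eq_one]

open MulOpposite in
/-- The antipode as an algebra map to the opposite algebra: `S(g) = g ^ (n - 1)`,
`S(h) = - q⁻¹ g ^ (n - 1) h`. -/
noncomputable def antipodeOp : TaftAlgebra hn hq →ₐ[k] (TaftAlgebra hn hq)ᵐᵒᵖ :=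
  lift hn hq (op (g hn hq ^ (n - 1))) (op ((-q⁻¹) • (g hn hq ^ (n - 1) * h hn hq)))
    (by rw [← op_pow, ← pow_mul, mul_comm, pow_mul, g_pow, one_pow, op_one])
    (by
      rw [← op_pow, smul_pow, mul_pow_eq_zero_of_qComm (h_mul_g_pow hn hq (n - 1)) (h_pow hn hq),
        smul_zero, op_zero])
    (by
      rw [← op_mul, ← op_mul, ← op_smul]
      congr 1
      rw [mul_smul_comm, smul_mul_assoc, smul_comm, mul_assoc _ (h hn hq), h_mul_g_pow,
        mul_smul_comm, smul_smul q, q_mul_q_pow hn hq, one_smul])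

/-- The antipode as a linear endomorphism. -/
noncomputable def antipode : TaftAlgebra hn hq →ₗ[k] TaftAlgebra hn hq :=
  (MulOpposite.opLinearEquiv k).symm.toLinearMap ∘ₗ (antipodeOp hn hq).toLinearMap

theorem antipode_mul (a b : TaftAlgebra hn hq) :
    antipode hn hq (a * b) = antipode hn hq b * antipode hn hq a :=
  congrArg MulOpposite.unop (map_mul (antipodeOp hn hq) a b)

theorem antipode_algebraMap (c : k) :
    antipode hn hq (algebraMap k _ c) = algebraMap k _ c :=
  congrArg MulOpposite.unop ((antipodeOp hn hq).commutes c)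

theorem antipode_g : antipode hn hq (g hn hq) = g hn hq ^ (n - 1) :=
  congrArg MulOpposite.unop (lift_g ..)

theorem antipode_h :
    antipode hn hq (h hn hq) = (-q⁻¹) • (g hn hq ^ (n - 1) * h hn hq) :=
  congrArg MulOpposite.unop (lift_h ..)

theorem antipode_one : antipode hn hq 1 = 1 :=
  congrArg MulOpposite.unop (map_one (antipodeOp hn hq))

open Coalgebra in
theorem antipode_left (a : TaftAlgebra hn hq) :
    LinearMap.mul' k _ ((antipode hn hq).rTensor _ (comul hn hq a)) =
      algebraMap k _ (counit hn hq a) := by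
  induction a using induction hn hq with
  | hg => rw [comul_g, counit_g]; simp [antipode_g, g_pow_mul_g]
  | hh =>
    rw [comul_h, counit_h]
    have h0 : q ≠ 0 := hq.ne_zero (by omega)
    simp [antipode_h, antipode_one, mul_assoc, h_mul_g]
    rw [← mul_assoc, g_pow_mul_g, one_mul, smul_smul, inv_mul_cancel₀ h0, one_smul, add_neg_cancel]
  | hc c => simp [AlgHom.commutes, Algebra.TensorProduct.algebraMap_apply, antipode_algebraMap]
  | hadd a b ha hb => simp only [map_add, ha, hb]
  | hmul a b ha hb =>
    have hr (x : TaftAlgebra hn hq) : comul hn hq x =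
      ∑ i ∈ (ℛ k x).index, (ℛ k x).left i ⊗ₜ[k] (ℛ k x).right i := (ℛ k x).eq.symm
    rw [hr] at ha hb
    simp only [map_sum, LinearMap.rTensor_tmul, LinearMap.mul'_apply] at ha hb
    rw [map_mul (comul hn hq), map_mul (counit hn hq), hr a, hr b, Finset.sum_mul_sum]
    simp only [map_sum, Algebra.TensorProduct.tmul_mul_tmul, LinearMap.rTensor_tmul,
      LinearMap.mul'_apply, antipode_mul]
    rw [Finset.sum_comm, map_mul (algebraMap k _), ← hb, Finset.mul_sum]
    refine Finset.sum_congr rfl fun j _ => ?_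
    rw [← mul_assoc, (Algebra.commutes _ _ : algebraMap k _ (counit hn hq a) * _ = _), ← ha,
      Finset.mul_sum, Finset.sum_mul]
    refine Finset.sum_congr rfl fun i _ => ?_
    simp only [mul_assoc]

open Coalgebra in
theorem antipode_right (a : TaftAlgebra hn hq) :
    LinearMap.mul' k _ ((antipode hn hq).lTensor _ (comul hn hq a)) =
      algebraMap k _ (counit hn hq a) := by
  induction a using induction hn hq with
  | hg => rw [comul_g, counit_g]; simp [antipode_g, g_mul_g_pow]
  | hh =>
    rw [comul_h, counit_h]
    have h0 : q⁻¹ = q ^ (n - 1) := inv_eq_of_mul_eq_one_right (q_mul_q_pow hn hq)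
    simp [antipode_h, antipode_g, h_mul_g_pow, h0]
  | hc c => simp [AlgHom.commutes, Algebra.TensorProduct.algebraMap_apply, antipode_one]
  | hadd a b ha hb => simp only [map_add, ha, hb]
  | hmul a b ha hb =>
    have hr (x : TaftAlgebra hn hq) : comul hn hq x =
      ∑ i ∈ (ℛ k x).index, (ℛ k x).left i ⊗ₜ[k] (ℛ k x).right i := (ℛ k x).eq.symm
    rw [hr] at ha hb
    simp only [map_sum, LinearMap.lTensor_tmul, LinearMap.mul'_apply] at ha hb
    rw [map_mul (comul hn hq), map_mul (counit hn hq), hr a, hr b, Finset.sum_mul_sum]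
    simp only [map_sum, Algebra.TensorProduct.tmul_mul_tmul, LinearMap.lTensor_tmul,
      LinearMap.mul'_apply, antipode_mul]
    rw [map_mul (algebraMap k _), ← ha, Finset.sum_mul]
    refine Finset.sum_congr rfl fun i _ => ?_
    rw [mul_assoc, ← (Algebra.commutes _ _ : algebraMap k _ (counit hn hq b) * _ = _), ← hb,
      Finset.sum_mul, Finset.mul_sum]
    refine Finset.sum_congr rfl fun j _ => ?_
    simp only [mul_assoc]

noncomputable instance hopfAlgebra : HopfAlgebra k (TaftAlgebra hn hq) where
  antipode := antipode hn hq
  mul_antipode_rTensor_comul := LinearMap.ext (antipode_left hn hq)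
  mul_antipode_lTensor_comul := LinearMap.ext (antipode_right hn hq)

/-! ## The modules `S_i` and `M(l, i)` -/

/-- The one-dimensional simple module `S_i`: `g` acts as `q ^ i` and `h` as `0`. -/
noncomputable def simpleModule (i : ℤ) : FDModule k (TaftAlgebra hn hq) :=
  FDModule.ofAction k ((Algebra.lmul k k).comp
    (lift hn hq (q ^ i) 0
      (by rw [← zpow_natCast, ← zpow_mul, mul_comm, zpow_mul, zpow_natCast, hq.pow_eq_one,
        one_zpow])
      (zero_pow (by omega)) (by simp)))

/-- The matrix of `g` on `M(l, i)`: diagonal with entries `q^i, q^(i-1), …, q^(i-l+1)`. -/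
def gMatrix (q : k) (l : ℕ) (i : ℤ) : Matrix (Fin l) (Fin l) k :=
  Matrix.diagonal fun j => q ^ (i - (j : ℕ))

/-- The matrix of `h` on `M(l, i)`: ones on the subdiagonal and zeros elsewhere. -/
def hMatrix (k : Type u) [Field k] (l : ℕ) : Matrix (Fin l) (Fin l) k :=
  Matrix.of fun r c => if (r : ℕ) = (c : ℕ) + 1 then 1 else 0

theorem gMatrix_pow (hq : IsPrimitiveRoot q n) (l : ℕ) (i : ℤ) : gMatrix q l i ^ n = 1 := by
  rw [gMatrix, Matrix.diagonal_pow, ← Matrix.diagonal_one]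
  congr 1
  funext j
  rw [Pi.pow_apply, ← zpow_natCast, ← zpow_mul, mul_comm, zpow_mul, zpow_natCast, hq.pow_eq_one,
    one_zpow]

theorem hMatrix_pow_apply (l m : ℕ) (r c : Fin l) (h : (r : ℕ) < c + m) :
    (hMatrix k l ^ m) r c = 0 := by
  induction m generalizing c with
  | zero => rw [pow_zero, Matrix.one_apply_ne]; rintro rfl; omega
  | succ m ih =>
    rw [pow_succ, Matrix.mul_apply]
    refine Finset.sum_eq_zero fun j _ => ?_
    by_cases hj : (j : ℕ) = c + 1
    · rw [ih j (by omega), zero_mul]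
    · rw [hMatrix, Matrix.of_apply, if_neg hj, mul_zero]

theorem hMatrix_pow {l : ℕ} (hl : l ≤ n) : hMatrix k l ^ n = 0 := by
  ext r c
  exact hMatrix_pow_apply l n r c (by omega)

theorem hMatrix_mul_gMatrix (hn : 2 ≤ n) (hq : IsPrimitiveRoot q n) (l : ℕ) (i : ℤ) :
    hMatrix k l * gMatrix q l i = q • (gMatrix q l i * hMatrix k l) := by
  have h0 : q ≠ 0 := hq.ne_zero (by omega)
  ext r c
  rw [Matrix.smul_apply, gMatrix, Matrix.mul_diagonal, Matrix.diagonal_mul, hMatrix,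
    Matrix.of_apply]
  split_ifs with hrc
  · rw [one_mul, mul_one, smul_eq_mul, ← zpow_one_add₀ h0, hrc]
    congr 1
    push_cast
    ring
  · simp

/-- The `l`-dimensional module `M(l, i)`, for `l ≤ n`: the space of column vectors, on which `g` and
`h` act through the matrices above (indecomposable when `1 ≤ l`). -/
noncomputable def indecModule (l : ℕ) (hl : l ≤ n) (i : ℤ) : FDModule k (TaftAlgebra hn hq) :=
  FDModule.ofAction (Fin l → k) ((Matrix.toLinAlgEquiv' : _ ≃ₐ[k] _).toAlgHom.comp
    (lift hn hq (gMatrix q l i) (hMatrix k l) (gMatrix_pow hq l i) (hMatrix_pow hl)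
      (hMatrix_mul_gMatrix hn hq l i)))

end TaftAlgebra

/-! ## The polynomial side -/

open MvPolynomial in
/-- The generalized Fibonacci polynomials `f_m(y, z)`, with `y = X 0` and `z = X 1`; the value at
`m = 0` is the one for which the recursion holds from `m = 2` on, so that `f_2 = z`. -/
noncomputable def genFib : ℕ → MvPolynomial (Fin 2) ℤ
  | 0 => 0
  | 1 => 1
  | m + 2 => X 1 * genFib (m + 1) - X 0 * genFib m

open MvPolynomial in
/-- The ideal of `ℤ[y, z]` generated by `y ^ n - 1` and `(z - y - 1) f_n(y, z)`. -/
noncomputable def fibIdeal (n : ℕ) : Ideal (MvPolynomial (Fin 2) ℤ) :=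
  Ideal.span {X 0 ^ n - 1, (X 1 - X 0 - 1) * genFib n}

/-! The map sends $n^2$ generators of the polynomial quotient to a $\mathbb Z$-basis of the Green
ring, so it is bijective.

On the module side, $M(l,i)$ is the cyclic module on a $g$-eigenvector $a$ of weight $q^i$ with $h^l
a=0$ (`exists_hom_of_weight`), so a tensor product is decomposed by exhibiting weight vectors that
generate it and comparing dimensions. Tensoring with $S_e$ on either side shifts $i$ by $e$, so
$[S_{-1}]$ and $[M(2,0)]$ commute. The decomposition of $M(2,0)\otimes M(l,0)$ is $M(l+1,0)\oplus
M(l-1,-1)$ for $1\le l<n$ (`two_mul_of_lt`) and $M(n,0)\oplus M(n,-1)$ for $l=n$ (`two_mul_self`).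
The first is the recursion for $f_l$, so $f_l\mapsto[M(l,0)]$ for $l\le n$ and $y^a
f_l\mapsto[M(l,-a)]$; the second says that $(z-y-1)f_n$ maps to $0$.

The same recursion and the relations show that the $y^a f_l$ with $0\le a<n$, $1\le l\le n$ span
$\mathbb Z[y,z]/I$ (`span_monomial_mul_genFib`). Their images generate the Green ring, because every
nonzero module has some $M(l,i)$ as a direct summand (`exists_split`). They are independent, because
the rank of a fixed algebra element is additive on direct sums, and differences of the ranks of $h^m
e_i$, with $e_i$ proportional to an eigenprojection of $g$, count the summands $M(l,i)$ with $l>m$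
(`tailMult_indecModule`). Neither the Krull–Schmidt theorem nor commutativity of the Green ring is
assumed. -/

theorem Submodule.finrank_prod {k M N : Type*} [Field k] [AddCommGroup M] [Module k M]
    [Module.Finite k M] [AddCommGroup N] [Module k N] [Module.Finite k N]
    (p : Submodule k M) (p' : Submodule k N) :
    Module.finrank k (p.prod p') = Module.finrank k p + Module.finrank k p' := by
  rw [← Module.finrank_prod]
  exact LinearEquiv.finrank_eq
    { toFun := fun x => (⟨x.1.1, x.2.1⟩, ⟨x.1.2, x.2.2⟩)
      invFun := fun y => ⟨(y.1, y.2), y.1.2, y.2.2⟩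
      map_add' := fun _ _ => rfl
      map_smul' := fun _ _ => rfl
      left_inv := fun _ => rfl
      right_inv := fun _ => rfl }

/-! ### Relations in the Green ring and additive rank functions -/

section GreenClass

variable {k : Type u} {H : Type v} [Field k] [Ring H] [Bialgebra k H]

theorem FDModule.greenClass_congr {V W : FDModule k H} (h : V ≈ W) :
    V.greenClass = W.greenClass :=
  congrArg (Ideal.Quotient.mk (greenIdeal k H)) (FDModule.freeClass_eq h)

theorem FDModule.greenClass_mul (V W : FDModule k H) :
    V.greenClass * W.greenClass = (V.tensor W).greenClass :=
  congrArg (Ideal.Quotient.mk (greenIdeal k H)) (FDModule.freeClass_mul V W)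

theorem FDModule.greenClass_directSum (V W : FDModule k H) :
    (V.directSum W).greenClass = V.greenClass + W.greenClass := by
  refine (Ideal.Quotient.eq (I := greenIdeal k H)).2 ?_
  exact AddSubgroup.subset_closure ⟨V, W, rfl⟩

theorem FDModule.greenClass_trivial : (FDModule.trivial k H).greenClass = 1 := rfl

/-- The rank of the action of `a`. -/
noncomputable def FDModule.rank (a : H) (V : FDModule k H) : ℕ :=
  Module.finrank k (LinearMap.range (V.action a))

theorem FDModule.rank_congr (a : H) {V W : FDModule k H} (h : V ≈ W) : V.rank a = W.rank a := by
  obtain ⟨e⟩ := h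
  have h1 := FDModule.baseEquiv_action e a
  have h2 : LinearMap.range (W.action a) =
      (LinearMap.range (V.action a)).map (FDModule.baseEquiv e).toLinearMap := by
    rw [← LinearMap.range_comp, h1, LinearMap.range_comp, LinearEquiv.range, Submodule.map_top]
  rw [FDModule.rank, FDModule.rank, h2]
  exact (LinearEquiv.finrank_map_eq _ _).symm

theorem FDModule.rank_directSum (a : H) (V W : FDModule k H) :
    (V.directSum W).rank a = V.rank a + W.rank a := by
  have h1 : LinearMap.range ((V.directSum W).action a) =
      (LinearMap.range (V.action a)).prod (LinearMap.range (W.action a)) :=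
    LinearMap.range_prodMap (V.action a) (W.action a)
  rw [FDModule.rank, h1]
  exact Submodule.finrank_prod _ _

/-- The rank of the action of `a`, as a function on isomorphism classes. -/
noncomputable def IsoClass.rank (a : H) : IsoClass k H → ℤ :=
  Quotient.lift (fun V : FDModule k H => (V.rank a : ℤ))
    fun _ _ h => congrArg Nat.cast (FDModule.rank_congr a h)

theorem IsoClass.lift_rank_freeClass (a : H) (V : FDModule k H) :
    FreeAbelianGroup.lift (IsoClass.rank a) V.freeClass = V.rank a :=
  FreeAbelianGroup.lift_apply_of _ _

/-- The rank of the action of `a`, as an additive function on the Green ring. -/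
noncomputable def GreenRing.rankHom (a : H) : GreenRing k H →+ ℤ :=
  QuotientAddGroup.lift (greenSubgroup k H) (FreeAbelianGroup.lift (IsoClass.rank a)) (by
    refine (AddSubgroup.closure_le _).2 ?_
    rintro _ ⟨M, V, rfl⟩
    change FreeAbelianGroup.lift (IsoClass.rank a) _ = 0
    rw [map_sub, map_add, IsoClass.lift_rank_freeClass, IsoClass.lift_rank_freeClass,
      IsoClass.lift_rank_freeClass, FDModule.rank_directSum, Nat.cast_add, sub_self])

theorem GreenRing.rankHom_greenClass (a : H) (V : FDModule k H) :
    GreenRing.rankHom a V.greenClass = V.rank a :=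
  IsoClass.lift_rank_freeClass a V

theorem GreenRing.induction {P : GreenRing k H → Prop} (zero : P 0)
    (of : ∀ V : FDModule k H, P V.greenClass) (add : ∀ x y, P x → P y → P (x + y))
    (neg : ∀ x, P x → P (-x)) (x : GreenRing k H) : P x := by
  obtain ⟨x, rfl⟩ := Ideal.Quotient.mk_surjective x
  induction x using FreeAbelianGroup.induction_on with
  | zero => exact zero
  | of c =>
    obtain ⟨V, rfl⟩ := Quotient.exists_rep c
    exact of V
  | neg c hc => exact neg _ hc
  | add a b ha hb => exact add _ _ ha hb

/-- The kernel of a homomorphism of modules. -/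
def FDModule.ker {V W : FDModule k H} (p : V.carrier →ₗ[H] W.carrier) : FDModule k H where
  carrier := LinearMap.ker p
  finite := inferInstanceAs (Module.Finite k ((LinearMap.ker p).restrictScalars k))

theorem FDModule.equiv_directSum_ker {V W : FDModule k H} (p : V.carrier →ₗ[H] W.carrier)
    (s : W.carrier →ₗ[H] V.carrier) (hs : p ∘ₗ s = LinearMap.id) :
    V ≈ W.directSum (FDModule.ker p) := by
  have hp (w) : p (s w) = w := LinearMap.congr_fun hs w
  let f : V.carrier →ₗ[H] W.carrier × LinearMap.ker p :=
    p.prod ((LinearMap.id - s ∘ₗ p).codRestrict (LinearMap.ker p) fun v => by simp [hp])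
  let f' : W.carrier × LinearMap.ker p →ₗ[H] V.carrier :=
    s.coprod (LinearMap.ker p).subtype
  have hf (v) : f' (f v) = v := add_sub_cancel (s (p v)) v
  have hf' (y) : f (f' y) = y := by
    obtain ⟨w, x, hx⟩ := y
    have hx : p x = 0 := hx
    have h1 : p (s w + x) = w := by rw [map_add, hp, hx, add_zero]
    refine Prod.ext h1 (Subtype.ext ?_)
    change s w + x - s (p (s w + x)) = x
    rw [h1, add_sub_cancel_left]
  exact ⟨{ f with invFun := f', left_inv := hf, right_inv := hf' }⟩

/-- A zero module satisfies $V\oplus V\cong V$, and one copy of $[V]$ cancels. This makes $M(0,i)$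
usable in the recursion. -/
theorem FDModule.greenClass_eq_zero_of_finrank {V : FDModule k H}
    (h : Module.finrank k V.carrier = 0) : V.greenClass = 0 := by
  have hV : Subsingleton V.carrier := Module.finrank_zero_iff.1 h
  have h1 : V.directSum V ≈ V := ⟨LinearEquiv.ofBijective (LinearMap.fst H V.carrier V.carrier)
    ⟨fun _ _ _ => Prod.ext (Subsingleton.elim _ _) (Subsingleton.elim _ _),
      fun v => ⟨(v, v), rfl⟩⟩⟩
  have h2 := FDModule.greenClass_congr h1
  rwa [FDModule.greenClass_directSum, add_eq_left] at h2

/-- A surjective homomorphism from `U ⊕ V` to a module of the same dimension gives a relation. -/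
theorem FDModule.greenClass_eq_add {U V W : FDModule k H} (f : U.carrier →ₗ[H] W.carrier)
    (f' : V.carrier →ₗ[H] W.carrier) (h : LinearMap.range f ⊔ LinearMap.range f' = ⊤)
    (hd : Module.finrank k W.carrier = Module.finrank k U.carrier + Module.finrank k V.carrier) :
    W.greenClass = U.greenClass + V.greenClass := by
  have hs : Function.Surjective (f.coprod f') := by
    rw [← LinearMap.range_eq_top, LinearMap.range_coprod, h]
  have hi : Function.Injective ((f.coprod f').restrictScalars k) :=
    (LinearMap.injective_iff_surjective_of_finrank_eq_finrank
      (by rw [Module.finrank_prod, hd])).2 hs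
  rw [← FDModule.greenClass_directSum]
  exact (FDModule.greenClass_congr
    (V := U.directSum V) ⟨LinearEquiv.ofBijective (f.coprod f') ⟨hi, hs⟩⟩).symm

theorem FDModule.greenClass_eq {V W : FDModule k H} (f : V.carrier →ₗ[H] W.carrier)
    (h : LinearMap.range f = ⊤)
    (hd : Module.finrank k W.carrier = Module.finrank k V.carrier) :
    W.greenClass = V.greenClass := by
  have hs : Function.Surjective f := LinearMap.range_eq_top.1 h
  have hi : Function.Injective (f.restrictScalars k) :=
    (LinearMap.injective_iff_surjective_of_finrank_eq_finrank hd.symm).2 hs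
  exact (FDModule.greenClass_congr (V := V) ⟨LinearEquiv.ofBijective f ⟨hi, hs⟩⟩).symm

/-- The pure tensors, as a bilinear map into the tensor product of modules. -/
noncomputable def FDModule.tmul (V W : FDModule k H) :
    V.carrier →ₗ[k] W.carrier →ₗ[k] (V.tensor W).carrier :=
  TensorProduct.mk k V.carrier W.carrier

theorem FDModule.smul_tmul (V W : FDModule k H) (a : H) (v : V.carrier) (w : W.carrier) :
    a • V.tmul W v w = TensorProduct.map (V.orbit v) (W.orbit w) (Coalgebra.comul a) :=
  FDModule.tensorAction_tmul V W v w a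

theorem FDModule.finrank_tensor (V W : FDModule k H) :
    Module.finrank k (V.tensor W).carrier =
      Module.finrank k V.carrier * Module.finrank k W.carrier :=
  Module.finrank_tensorProduct (R := k) (S := k) (M := V.carrier) (M' := W.carrier)

/-- Pure tensors of spanning vectors span, so surjectivity onto a tensor product can be tested on
basis vectors. -/
theorem FDModule.tensor_eq_top {V W : FDModule k H} {N : Submodule H (V.tensor W).carrier}
    {S : Set V.carrier} {T : Set W.carrier} (hS : Submodule.span k S = ⊤)
    (hT : Submodule.span k T = ⊤) (h : ∀ v ∈ S, ∀ w ∈ T, V.tmul W v w ∈ N) : N = ⊤ := by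
  have h1 (v) (hv : v ∈ S) (w) : V.tmul W v w ∈ N := by
    have : Submodule.span k T ≤ (N.restrictScalars k).comap (V.tmul W v) :=
      Submodule.span_le.2 (h v hv)
    exact this (hT ▸ Submodule.mem_top)
  have h2 (w) (v) : V.tmul W v w ∈ N := by
    have : Submodule.span k S ≤ (N.restrictScalars k).comap ((V.tmul W).flip w) :=
      Submodule.span_le.2 fun v hv => h1 v hv w
    exact this (hS ▸ Submodule.mem_top)
  refine eq_top_iff.2 fun x _ => ?_
  change (x : V.carrier ⊗[k] W.carrier) ∈ N.restrictScalars k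
  have : (⊤ : Submodule k (V.carrier ⊗[k] W.carrier)) ≤ N.restrictScalars k := by
    rw [← TensorProduct.span_tmul_eq_top]
    refine Submodule.span_le.2 ?_
    rintro _ ⟨v, w, rfl⟩
    exact h2 w v
  exact this Submodule.mem_top

end GreenClass

namespace TaftAlgebra

variable {k : Type u} [Field k] {n : ℕ} (hn : 2 ≤ n) {q : k} (hq : IsPrimitiveRoot q n)

/-! ### Module homomorphisms and actions in terms of $g$ and $h$ -/

section Homs

variable {hn hq} {V W : FDModule k (TaftAlgebra hn hq)}

/-- A `k`-linear map that commutes with `g` and `h` is a homomorphism of modules. -/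
def linearMapOfGens (f : V.carrier →ₗ[k] W.carrier)
    (h_g : ∀ v, f (g hn hq • v) = g hn hq • f v) (h_h : ∀ v, f (h hn hq • v) = h hn hq • f v) :
    V.carrier →ₗ[TaftAlgebra hn hq] W.carrier :=
  { f with
    map_smul' := fun a v => by
      change f (a • v) = a • f v
      induction a using TaftAlgebra.induction hn hq generalizing v with
      | hg => exact h_g v
      | hh => exact h_h v
      | hc c => rw [algebraMap_smul, algebraMap_smul, map_smul]
      | hadd a b ha hb => rw [add_smul, add_smul, map_add, ha, hb]
      | hmul a b ha hb => rw [mul_smul, mul_smul, ha, hb] }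

theorem g_smul_h_smul (v : V.carrier) :
    g hn hq • h hn hq • v = q⁻¹ • h hn hq • g hn hq • v := by
  have h0 : q ≠ 0 := hq.ne_zero (by omega)
  rw [← mul_smul (h hn hq), h_mul_g, smul_assoc, inv_smul_smul₀ h0, mul_smul]

/-- Since $gh=q^{-1}hg$, each application of $h$ lowers the weight exponent by one. -/
theorem g_smul_h_pow_smul {i : ℤ} {v : V.carrier} (hv : g hn hq • v = q ^ i • v) (m : ℕ) :
    g hn hq • h hn hq ^ m • v = q ^ (i - m) • h hn hq ^ m • v := by
  have h0 : q ≠ 0 := hq.ne_zero (by omega)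
  induction m with
  | zero => simpa using hv
  | succ m ih =>
    rw [pow_succ', mul_smul, g_smul_h_smul, ih, smul_comm (h hn hq), smul_smul, ← zpow_neg_one,
      ← zpow_add₀ h0]
    congr 2
    push_cast
    ring

theorem g_pow_smul {c : k} {v : V.carrier} (hv : g hn hq • v = c • v) (m : ℕ) :
    g hn hq ^ m • v = c ^ m • v := by
  induction m with
  | zero => simp
  | succ m ih => rw [pow_succ', mul_smul, ih, smul_comm, hv, smul_smul, ← pow_succ]

theorem g_smul_tmul (v : V.carrier) (w : W.carrier) :
    g hn hq • V.tmul W v w = V.tmul W (g hn hq • v) (g hn hq • w) := by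
  rw [FDModule.smul_tmul]
  exact congrArg (TensorProduct.map (V.orbit v) (W.orbit w)) (comul_g hn hq)

theorem h_smul_tmul (v : V.carrier) (w : W.carrier) :
    h hn hq • V.tmul W v w =
      V.tmul W v (h hn hq • w) + V.tmul W (h hn hq • v) (g hn hq • w) := by
  rw [FDModule.smul_tmul]
  refine (congrArg (TensorProduct.map (V.orbit v) (W.orbit w)) (comul_h hn hq)).trans ?_
  rw [map_add]
  refine congrArg₂ (· + ·) ?_ rfl
  exact congrArg (fun x => V.tmul W x (h hn hq • w)) (one_smul (TaftAlgebra hn hq) v)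

end Homs

/-! ### The modules $M(l,i)$ and their universal property -/

section Indec

/-- The basis vectors of `M(l, i)`, continued by zero. -/
noncomputable def vec (l : ℕ) (hl : l ≤ n) (i : ℤ) (s : ℕ) :
    (indecModule hn hq l hl i).carrier :=
  if hs : s < l then (Pi.single ⟨s, hs⟩ 1 : Fin l → k) else (0 : Fin l → k)

variable {hn hq} {l : ℕ} {hl : l ≤ n} {i : ℤ}

theorem g_smul_indec (v : (indecModule hn hq l hl i).carrier) :
    g hn hq • v = ((gMatrix q l i).mulVec v : Fin l → k) := by
  change Matrix.toLinAlgEquiv' (lift hn hq _ _ _ _ _ (g hn hq)) v = _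
  rw [lift_g]
  exact Matrix.toLinAlgEquiv'_apply _ _

theorem h_smul_indec (v : (indecModule hn hq l hl i).carrier) :
    h hn hq • v = ((hMatrix k l).mulVec v : Fin l → k) := by
  change Matrix.toLinAlgEquiv' (lift hn hq _ _ _ _ _ (h hn hq)) v = _
  rw [lift_h]
  exact Matrix.toLinAlgEquiv'_apply _ _

theorem vec_of_lt {s : ℕ} (hs : s < l) :
    vec hn hq l hl i s = (Pi.single ⟨s, hs⟩ 1 : Fin l → k) := dif_pos hs

theorem vec_of_le {s : ℕ} (hs : l ≤ s) : vec hn hq l hl i s = 0 := dif_neg (by omega)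

theorem vec_eq_zero_iff {s : ℕ} : vec hn hq l hl i s = 0 ↔ l ≤ s := by
  refine ⟨fun h0 => ?_, vec_of_le⟩
  by_contra hs
  rw [vec_of_lt (by omega)] at h0
  exact one_ne_zero (Pi.single_eq_zero_iff.1 h0)

theorem g_smul_vec (s : ℕ) :
    g hn hq • vec hn hq l hl i s = q ^ (i - s) • vec hn hq l hl i s := by
  by_cases hs : s < l
  · rw [g_smul_indec, vec_of_lt hs, gMatrix]
    funext r
    rw [Matrix.mulVec_single_one, Matrix.col_apply]
    change _ = q ^ (i - s) * (Pi.single (⟨s, hs⟩ : Fin l) (1 : k) : Fin l → k) r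
    by_cases hr : r = ⟨s, hs⟩
    · subst hr; simp
    · rw [Matrix.diagonal_apply_ne _ hr, Pi.single_eq_of_ne hr, mul_zero]
  · rw [vec_of_le (by omega), smul_zero, smul_zero]

theorem h_smul_vec (s : ℕ) :
    h hn hq • vec hn hq l hl i s = vec hn hq l hl i (s + 1) := by
  by_cases hs : s < l
  · rw [h_smul_indec, vec_of_lt hs]
    funext r
    rw [Matrix.mulVec_single_one, Matrix.col_apply, hMatrix, Matrix.of_apply]
    by_cases hs' : s + 1 < l
    · rw [vec_of_lt hs', Pi.single_apply]
      simp [Fin.ext_iff]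
    · rw [vec_of_le (by omega), if_neg (by simp; omega)]
      rfl
  · rw [vec_of_le (by omega), vec_of_le (by omega), smul_zero]

theorem h_pow_smul_vec (s m : ℕ) :
    h hn hq ^ m • vec hn hq l hl i s = vec hn hq l hl i (s + m) := by
  induction m with
  | zero => simp
  | succ m ih => rw [pow_succ', mul_smul, ih, h_smul_vec, add_assoc]

theorem span_vec : Submodule.span k (Set.range (vec hn hq l hl i)) = ⊤ := by
  rw [eq_top_iff]
  change (⊤ : Submodule k (Fin l → k)) ≤ _
  rw [← (Pi.basisFun k (Fin l)).span_eq]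
  refine Submodule.span_mono ?_
  rintro _ ⟨r, rfl⟩
  refine ⟨r, ?_⟩
  rw [vec_of_lt r.2, Pi.basisFun_apply]

theorem finrank_indecModule : Module.finrank k (indecModule hn hq l hl i).carrier = l :=
  Module.finrank_fin_fun k

variable {V : FDModule k (TaftAlgebra hn hq)}

/-- The two conditions on $a$ are exactly the relations on the generator of $M(l,i)$, so every such
$a$ is the image of that generator. All homomorphisms out of $M(l,i)$ below come from here. -/
theorem exists_hom_of_weight (l : ℕ) (hl : l ≤ n) (i : ℤ) (a : V.carrier)
    (ha : g hn hq • a = q ^ i • a) (hla : h hn hq ^ l • a = 0) :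
    ∃ f : (indecModule hn hq l hl i).carrier →ₗ[TaftAlgebra hn hq] V.carrier,
      ∀ s, f (vec hn hq l hl i s) = h hn hq ^ s • a := by
  let f : (indecModule hn hq l hl i).carrier →ₗ[k] V.carrier :=
    Fintype.linearCombination k fun j : Fin l => h hn hq ^ (j : ℕ) • a
  have hf (s) : f (vec hn hq l hl i s) = h hn hq ^ s • a := by
    by_cases hs : s < l
    · rw [vec_of_lt hs]
      refine (Fintype.linearCombination_apply_single k _ _ _).trans ?_
      rw [one_smul]
    · rw [vec_of_le (by omega), map_zero, show s = s - l + l by omega, pow_add, mul_smul, hla,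
        smul_zero]
  have ext (x y : (indecModule hn hq l hl i).carrier →ₗ[k] V.carrier)
      (hxy : ∀ s, x (vec hn hq l hl i s) = y (vec hn hq l hl i s)) : x = y :=
    LinearMap.ext_on span_vec (by rintro _ ⟨s, rfl⟩; exact hxy s)
  refine ⟨linearMapOfGens f (fun v => ?_) fun v => ?_, hf⟩
  · refine LinearMap.congr_fun (ext (f ∘ₗ FDModule.action _ (g hn hq))
      (V.action (g hn hq) ∘ₗ f) fun s => ?_) v
    change f (g hn hq • _) = g hn hq • f _
    rw [g_smul_vec, map_smul, hf, g_smul_h_pow_smul ha]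
  · refine LinearMap.congr_fun (ext (f ∘ₗ FDModule.action _ (h hn hq))
      (V.action (h hn hq) ∘ₗ f) fun s => ?_) v
    change f (h hn hq • _) = h hn hq • f _
    rw [h_smul_vec, hf, hf, pow_succ', mul_smul]

end Indec

/-! ### Tensor products with $S_e$ and with $M(2,0)$ -/

section Products

variable {hn hq} {l : ℕ} {hl : l ≤ n} {i : ℤ}

theorem greenClass_indec_congr (hl : l ≤ n) {i j : ℤ} (hij : q ^ i = q ^ j) :
    (indecModule hn hq l hl i).greenClass = (indecModule hn hq l hl j).greenClass := by
  obtain ⟨f, hf⟩ := exists_hom_of_weight (V := indecModule hn hq l hl i) l hl j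
    (vec hn hq l hl i 0)
    (by rw [g_smul_vec, Nat.cast_zero, sub_zero, hij])
    (by rw [h_pow_smul_vec, vec_of_le (by omega)])
  refine FDModule.greenClass_eq f ?_ (by rw [finrank_indecModule, finrank_indecModule])
  refine (Submodule.restrictScalars_eq_top_iff k (TaftAlgebra hn hq) _).1 (top_le_iff.1 ?_)
  rw [← span_vec, Submodule.span_le]
  rintro _ ⟨s, rfl⟩
  exact ⟨vec hn hq l hl j s, by rw [hf, h_pow_smul_vec, zero_add]⟩

theorem greenClass_indec_zero (h0 : 0 ≤ n) (i : ℤ) :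
    (indecModule hn hq 0 h0 i).greenClass = 0 :=
  FDModule.greenClass_eq_zero_of_finrank finrank_indecModule

theorem greenClass_indec_one (h1 : 1 ≤ n) : (indecModule hn hq 1 h1 0).greenClass = 1 := by
  let T := FDModule.trivial k (TaftAlgebra hn hq)
  let a : T.carrier := (1 : k)
  have hg : g hn hq • a = q ^ (0 : ℤ) • a := by
    change counit hn hq (g hn hq) * (1 : k) = q ^ (0 : ℤ) * (1 : k)
    rw [counit_g, zpow_zero]
  have hh : h hn hq ^ 1 • a = 0 := by
    rw [pow_one]
    change counit hn hq (h hn hq) * (1 : k) = 0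
    rw [counit_h, zero_mul]
  obtain ⟨f, hf⟩ := exists_hom_of_weight 1 h1 0 a hg hh
  rw [← FDModule.greenClass_trivial]
  refine (FDModule.greenClass_eq f (LinearMap.range_eq_top.2 fun c => ?_) ?_).symm
  · let c' : k := c
    refine ⟨c' • vec hn hq 1 h1 0 0, ?_⟩
    rw [LinearMap.map_smul_of_tower, hf, pow_zero, one_smul]
    exact mul_one c'
  · rw [finrank_indecModule]
    exact Module.finrank_self k

/-- The basis vector of `S_i`. -/
noncomputable def simpleVec (hn : 2 ≤ n) (hq : IsPrimitiveRoot q n) (i : ℤ) :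
    (simpleModule hn hq i).carrier := (1 : k)

theorem g_smul_simpleVec : g hn hq • simpleVec hn hq i = q ^ i • simpleVec hn hq i := by
  change lift hn hq _ _ _ _ _ (g hn hq) * (1 : k) = q ^ i * (1 : k)
  rw [lift_g]

theorem h_smul_simpleVec : h hn hq • simpleVec hn hq i = 0 := by
  change lift hn hq _ _ _ _ _ (h hn hq) * (1 : k) = 0
  rw [lift_h, zero_mul]

theorem span_simpleVec : Submodule.span k {simpleVec hn hq i} = ⊤ :=
  Ideal.span_singleton_one (α := k)

theorem finrank_simpleModule : Module.finrank k (simpleModule hn hq i).carrier = 1 :=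
  Module.finrank_self k

/-- As $h$ kills $S_e$, the summand $h\otimes g$ of $\Delta(h)$ vanishes and $h$ acts as $1\otimes
h$: the chain of basis vectors is unchanged, with all weights shifted by $e$. -/
theorem simpleModule_mul (e : ℤ) :
    (simpleModule hn hq e).greenClass * (indecModule hn hq l hl i).greenClass =
      (indecModule hn hq l hl (i + e)).greenClass := by
  have h0 : q ≠ 0 := hq.ne_zero (by omega)
  rw [FDModule.greenClass_mul]
  have hh (s m : ℕ) : h hn hq ^ m • (simpleModule hn hq e).tmul (indecModule hn hq l hl i)
      (simpleVec hn hq e) (vec hn hq l hl i s) = (simpleModule hn hq e).tmul _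
      (simpleVec hn hq e) (vec hn hq l hl i (s + m)) := by
    induction m with
    | zero => simp
    | succ m ih =>
      rw [pow_succ', mul_smul, ih, h_smul_tmul, h_smul_simpleVec, map_zero, LinearMap.zero_apply,
        add_zero, h_smul_vec, add_assoc]
  obtain ⟨f, hf⟩ := exists_hom_of_weight l hl (i + e)
    ((simpleModule hn hq e).tmul (indecModule hn hq l hl i) (simpleVec hn hq e)
      (vec hn hq l hl i 0))
    (by rw [g_smul_tmul, g_smul_simpleVec, g_smul_vec, map_smul, map_smul, LinearMap.smul_apply,
      smul_smul, ← zpow_add₀ h0, Nat.cast_zero, sub_zero])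
    (by rw [hh, vec_of_le (by omega), map_zero])
  refine FDModule.greenClass_eq f (FDModule.tensor_eq_top span_simpleVec span_vec ?_) ?_
  · rintro _ rfl _ ⟨s, rfl⟩
    exact ⟨vec hn hq l hl _ s, by rw [hf, hh, zero_add]⟩
  · rw [FDModule.finrank_tensor, finrank_simpleModule, finrank_indecModule, finrank_indecModule,
      one_mul]

/-- Here only $h\otimes g$ survives, so each step along the chain picks up the unit $q^e$, which has
to be divided out when generating the basis vectors. -/
theorem mul_simpleModule (e : ℤ) :
    (indecModule hn hq l hl i).greenClass * (simpleModule hn hq e).greenClass =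
      (indecModule hn hq l hl (i + e)).greenClass := by
  have h0 : q ≠ 0 := hq.ne_zero (by omega)
  rw [FDModule.greenClass_mul]
  have hh (s m : ℕ) : h hn hq ^ m • (indecModule hn hq l hl i).tmul (simpleModule hn hq e)
      (vec hn hq l hl i s) (simpleVec hn hq e) = (q ^ e) ^ m •
      (indecModule hn hq l hl i).tmul _ (vec hn hq l hl i (s + m)) (simpleVec hn hq e) := by
    induction m with
    | zero => simp
    | succ m ih =>
      rw [pow_succ', mul_smul, ih, smul_comm, h_smul_tmul, h_smul_simpleVec, map_zero,
        zero_add, h_smul_vec, g_smul_simpleVec, map_smul, smul_smul, add_assoc, pow_succ]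
  obtain ⟨f, hf⟩ := exists_hom_of_weight l hl (i + e)
    ((indecModule hn hq l hl i).tmul (simpleModule hn hq e) (vec hn hq l hl i 0)
      (simpleVec hn hq e))
    (by rw [g_smul_tmul, g_smul_simpleVec, g_smul_vec, map_smul, map_smul, LinearMap.smul_apply,
      smul_smul, ← zpow_add₀ h0, Nat.cast_zero, sub_zero, add_comm])
    (by rw [hh, vec_of_le (by omega), map_zero, LinearMap.zero_apply, smul_zero])
  refine FDModule.greenClass_eq f (FDModule.tensor_eq_top span_vec span_simpleVec ?_) ?_
  · rintro _ ⟨s, rfl⟩ _ rfl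
    refine ⟨((q ^ e) ^ s)⁻¹ • vec hn hq l hl _ s, ?_⟩
    rw [LinearMap.map_smul_of_tower, hf, hh, zero_add,
      inv_smul_smul₀ (pow_ne_zero _ (zpow_ne_zero _ h0))]
  · rw [FDModule.finrank_tensor, finrank_simpleModule, finrank_indecModule, finrank_indecModule,
      mul_one]

variable (hn hq l hl) in
/-- The vector `v_r ⊗ w_s` of `M(2, 0) ⊗ M(l, 0)`. -/
noncomputable def tvec (r s : ℕ) :
    ((indecModule hn hq 2 hn 0).tensor (indecModule hn hq l hl 0)).carrier :=
  FDModule.tmul _ _ (vec hn hq 2 hn 0 r) (vec hn hq l hl 0 s)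

theorem tvec_of_le_left {r s : ℕ} (hr : 2 ≤ r) : tvec hn hq l hl r s = 0 := by
  rw [tvec, vec_of_le hr, map_zero, LinearMap.zero_apply]

theorem tvec_of_le_right {r s : ℕ} (hs : l ≤ s) : tvec hn hq l hl r s = 0 := by
  rw [tvec, vec_of_le hs, map_zero]

theorem g_smul_tvec (r s : ℕ) :
    g hn hq • tvec hn hq l hl r s = q ^ (-((r + s : ℕ) : ℤ)) • tvec hn hq l hl r s := by
  have h0 : q ≠ 0 := hq.ne_zero (by omega)
  rw [tvec, g_smul_tmul, g_smul_vec, g_smul_vec, map_smul, map_smul, LinearMap.smul_apply,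
    smul_smul, ← zpow_add₀ h0]
  congr 2
  push_cast
  ring

theorem h_smul_tvec (r s : ℕ) :
    h hn hq • tvec hn hq l hl r s =
      tvec hn hq l hl r (s + 1) + q⁻¹ ^ s • tvec hn hq l hl (r + 1) s := by
  rw [tvec, h_smul_tmul, h_smul_vec, h_smul_vec, g_smul_vec, map_smul, zero_sub, zpow_neg,
    zpow_natCast, inv_pow]
  rfl

theorem h_pow_smul_tvec_one (s m : ℕ) :
    h hn hq ^ m • tvec hn hq l hl 1 s = tvec hn hq l hl 1 (s + m) := by
  induction m with
  | zero => simp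
  | succ m ih =>
    rw [pow_succ', mul_smul, ih, h_smul_tvec, tvec_of_le_left le_rfl, smul_zero, add_zero,
      add_assoc]

/-- The index $r$ can rise from $0$ to $1$ only once; summing over the moment when it does gives a
$q^{-1}$-integer as coefficient. -/
theorem h_pow_smul_tvec_zero (s m : ℕ) :
    h hn hq ^ (m + 1) • tvec hn hq l hl 0 s = tvec hn hq l hl 0 (s + (m + 1)) +
      (q⁻¹ ^ s * ∑ t ∈ Finset.range (m + 1), q⁻¹ ^ t) • tvec hn hq l hl 1 (s + m) := by
  induction m with
  | zero => simp [h_smul_tvec]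
  | succ m ih =>
    rw [pow_succ', mul_smul, ih, smul_add, smul_comm (h hn hq), h_smul_tvec, h_smul_tvec,
      tvec_of_le_left (r := 1 + 1) le_rfl, smul_zero, add_zero, Finset.sum_range_succ _ (m + 1),
      mul_add, ← pow_add, add_smul, add_assoc, zero_add, add_comm ((_ : k) • _) ((_ : k) • _)]
    rfl

/-- Applying $h$ to $v_1\otimes w_0$ gives all $v_1\otimes w_s$; modulo these, $h$ sends $v_0\otimes
w_s$ to $v_0\otimes w_{s+1}$. -/
theorem tensor_two_eq_top {N : Submodule (TaftAlgebra hn hq)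
      ((indecModule hn hq 2 hn 0).tensor (indecModule hn hq l hl 0)).carrier}
    (h0 : tvec hn hq l hl 0 0 ∈ N) (h1 : tvec hn hq l hl 1 0 ∈ N) : N = ⊤ := by
  have h1' (s) : tvec hn hq l hl 1 s ∈ N := by
    have := N.smul_mem (h hn hq ^ s) h1
    rwa [h_pow_smul_tvec_one, zero_add] at this
  have h0' (s) : tvec hn hq l hl 0 s ∈ N := by
    induction s with
    | zero => exact h0
    | succ s ih =>
      have := N.smul_mem (h hn hq) ih
      rw [h_smul_tvec] at this
      exact (N.add_mem_iff_left (N.smul_of_tower_mem _ (h1' s))).1 this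
  refine FDModule.tensor_eq_top span_vec span_vec ?_
  rintro _ ⟨r, rfl⟩ _ ⟨s, rfl⟩
  change tvec hn hq l hl r s ∈ N
  match r with
  | 0 => exact h0' s
  | 1 => exact h1' s
  | r + 2 =>
    rw [tvec_of_le_left (by omega)]
    exact N.zero_mem

theorem geom_sum_inv_ne_zero (hq : IsPrimitiveRoot q n) {m : ℕ} (h0 : m ≠ 0) (hm : m < n) :
    ∑ t ∈ Finset.range m, q⁻¹ ^ t ≠ 0 := by
  intro hs
  have h1 := geom_sum_mul q⁻¹ m
  rw [hs, zero_mul] at h1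
  exact hq.inv.pow_ne_one_of_pos_of_lt h0 hm (sub_eq_zero.1 h1.symm)

/-- The summand $M(m+2,0)$ is generated by $v_0\otimes w_0$, and $M(m,-1)$ by a vector of weight
$-1$ killed by $h^m$. They fill the tensor product because the $q^{-1}$-integer of $m+1<n$ is
nonzero. -/
theorem two_mul_of_lt {m : ℕ} (hm : m + 2 ≤ n) (hl : m + 1 ≤ n) (hm' : m ≤ n) :
    (indecModule hn hq 2 hn 0).greenClass * (indecModule hn hq (m + 1) hl 0).greenClass =
      (indecModule hn hq (m + 2) hm 0).greenClass +
        (indecModule hn hq m hm' (-1)).greenClass := by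
  rw [FDModule.greenClass_mul]
  obtain ⟨f, hf⟩ := exists_hom_of_weight (m + 2) hm 0 (tvec hn hq (m + 1) hl 0 0)
    (by rw [g_smul_tvec]; rfl)
    (by
      rw [h_pow_smul_tvec_zero, tvec_of_le_right (by omega), tvec_of_le_right (by omega),
        smul_zero, add_zero])
  -- $h^m$ sends $v_0\otimes w_1$ to $c\,(v_1\otimes w_m)$ and $v_1\otimes w_0$ to $v_1\otimes w_m$,
  -- so this $c$ makes the difference below vanish under $h^m$.
  let c : k := q⁻¹ * ∑ t ∈ Finset.range m, q⁻¹ ^ t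
  obtain ⟨f', hf'⟩ := exists_hom_of_weight m hm' (-1)
    (tvec hn hq (m + 1) hl 0 1 - c • tvec hn hq (m + 1) hl 1 0)
    (by
      rw [smul_sub, smul_comm, g_smul_tvec, g_smul_tvec, smul_sub, smul_comm c]
      rfl)
    (by
      rcases m with _ | m
      · simp [c, tvec_of_le_right]
      · rw [smul_sub, smul_comm, h_pow_smul_tvec_one, h_pow_smul_tvec_zero,
          tvec_of_le_right (by omega), pow_one, zero_add, zero_add, add_comm 1 m, sub_self])
  refine FDModule.greenClass_eq_add f f' (tensor_two_eq_top ?_ ?_) ?_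
  · exact Submodule.mem_sup_left ⟨vec hn hq _ _ _ 0, by rw [hf, pow_zero, one_smul]⟩
  -- Subtracting the generator of the second summand from $h(v_0\otimes w_0)$ leaves
  -- $(1+c)(v_1\otimes w_0)$, where $1+c$ is the $q^{-1}$-integer of $m+1$.
  · have h1 : tvec hn hq (m + 1) hl 0 1 + tvec hn hq (m + 1) hl 1 0 ∈
        LinearMap.range f ⊔ LinearMap.range f' :=
      Submodule.mem_sup_left ⟨vec hn hq _ _ _ 1, by
        rw [hf, pow_one, h_smul_tvec, pow_zero, one_smul]⟩
    have h2 : tvec hn hq (m + 1) hl 0 1 - c • tvec hn hq (m + 1) hl 1 0 ∈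
        LinearMap.range f ⊔ LinearMap.range f' :=
      Submodule.mem_sup_right ⟨vec hn hq _ _ _ 0, by rw [hf', pow_zero, one_smul]⟩
    have h3 := Submodule.sub_mem _ h1 h2
    have hc : 1 + c ≠ 0 := by
      have := geom_sum_inv_ne_zero hq (Nat.succ_ne_zero m) (by omega)
      rwa [geom_sum_succ, add_comm] at this
    rw [add_sub_sub_cancel] at h3
    nth_rw 1 [← one_smul k (tvec hn hq (m + 1) hl 1 0)] at h3
    rw [← add_smul] at h3
    have h4 := Submodule.smul_of_tower_mem _ (1 + c)⁻¹ h3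
    rwa [inv_smul_smul₀ hc] at h4
  · simp only [FDModule.finrank_tensor, finrank_indecModule]
    omega

/-- At $l=n$ the $q^{-1}$-integer used above becomes zero, but $h^n=0$ allows any weight vector to
receive a map from $M(n,\cdot)$, so $v_0\otimes w_0$ and $v_1\otimes w_0$ can be used directly. -/
theorem two_mul_self :
    (indecModule hn hq 2 hn 0).greenClass * (indecModule hn hq n le_rfl 0).greenClass =
      (indecModule hn hq n le_rfl 0).greenClass +
        (indecModule hn hq n le_rfl (-1)).greenClass := by
  rw [FDModule.greenClass_mul]
  obtain ⟨f, hf⟩ := exists_hom_of_weight n le_rfl 0 (tvec hn hq n le_rfl 0 0)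
    (by rw [g_smul_tvec]; rfl) (by rw [h_pow, zero_smul])
  obtain ⟨f', hf'⟩ := exists_hom_of_weight n le_rfl (-1) (tvec hn hq n le_rfl 1 0)
    (by rw [g_smul_tvec]; rfl) (by rw [h_pow, zero_smul])
  refine FDModule.greenClass_eq_add f f' (tensor_two_eq_top ?_ ?_) ?_
  · exact Submodule.mem_sup_left ⟨vec hn hq _ _ _ 0, by rw [hf, pow_zero, one_smul]⟩
  · exact Submodule.mem_sup_right ⟨vec hn hq _ _ _ 0, by rw [hf', pow_zero, one_smul]⟩
  · simp only [FDModule.finrank_tensor, finrank_indecModule]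
    omega

end Products

/-! ### Eigenprojections of $g$ -/

section WeightSum

/-- The element `∑ q ^ (-i t) g ^ t`, which acts as `n` times the projection to the `q ^ i`-eigenspace
of `g`. -/
noncomputable def weightSum (i : ℤ) : TaftAlgebra hn hq :=
  ∑ t ∈ Finset.range n, (q ^ (-i)) ^ t • g hn hq ^ t

theorem zpow_pow_eq_one {q : k} (hq : IsPrimitiveRoot q n) (i : ℤ) : (q ^ i) ^ n = 1 := by
  rw [← zpow_natCast, ← zpow_mul, mul_comm, zpow_mul, zpow_natCast, hq.pow_eq_one, one_zpow]

/-- A primitive $n$-th root of unity exists only if the characteristic does not divide $n$; hence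
`weightSum` can be normalised to a projection. -/
theorem natCast_ne_zero (hn : 2 ≤ n) (hq : IsPrimitiveRoot q n) : (n : k) ≠ 0 :=
  haveI : NeZero n := ⟨by omega⟩
  hq.neZero'.out

theorem h_pow_mul_g (m : ℕ) : h hn hq ^ m * g hn hq = q ^ m • (g hn hq * h hn hq ^ m) := by
  induction m with
  | zero => simp
  | succ m ih =>
    rw [pow_succ', mul_assoc, ih, mul_smul_comm, ← mul_assoc, h_mul_g, smul_mul_assoc, smul_smul,
      ← pow_succ, mul_assoc]

theorem g_mul_weightSum (i : ℤ) :
    g hn hq * weightSum hn hq i = q ^ i • weightSum hn hq i := by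
  have h0 : q ≠ 0 := hq.ne_zero (by omega)
  have h1 : q ^ i * q ^ (-i) = 1 := by rw [← zpow_add₀ h0, add_neg_cancel, zpow_zero]
  -- The summand is $n$-periodic in $t$, so the sum may start at $1$ instead of $0$.
  have h2 := Finset.sum_range_succ (fun t => (q ^ (-i)) ^ t • g hn hq ^ t) n
  rw [Finset.sum_range_succ', g_pow, zpow_pow_eq_one hq, pow_zero, pow_zero] at h2
  have h3 := add_right_cancel h2
  rw [weightSum, ← h3, Finset.smul_sum, h3, Finset.mul_sum]
  refine Finset.sum_congr rfl fun t _ => ?_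
  rw [mul_smul_comm, ← pow_succ', smul_smul, pow_succ' (q ^ (-i)), ← mul_assoc, h1, one_mul]

/-- Orthogonality of characters: after exchanging the sums, the coefficient of $g^t$ is a full
geometric sum of $q^{-t}$, which vanishes unless $t=0$. -/
theorem sum_weightSum :
    ∑ i ∈ Finset.range n, weightSum hn hq i = (n : k) • (1 : TaftAlgebra hn hq) := by
  unfold weightSum
  rw [Finset.sum_comm, Finset.sum_eq_single_of_mem 0 (Finset.mem_range.2 (by omega))]
  · simp [Nat.cast_smul_eq_nsmul]
  · intro t ht ht0
    have h1 : q⁻¹ ^ t ≠ 1 := hq.inv.pow_ne_one_of_pos_of_lt ht0 (Finset.mem_range.1 ht)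
    have h2 := geom_sum_mul (q⁻¹ ^ t) n
    rw [← pow_mul, mul_comm t, pow_mul, hq.inv.pow_eq_one, one_pow, sub_self] at h2
    rw [← Finset.sum_smul]
    convert zero_smul k _
    rw [← (mul_eq_zero.1 h2).resolve_right (sub_ne_zero.2 h1)]
    refine Finset.sum_congr rfl fun i _ => ?_
    rw [zpow_neg, zpow_natCast, ← inv_pow, ← pow_mul, ← pow_mul, mul_comm]

variable {hn hq} {V : FDModule k (TaftAlgebra hn hq)}

theorem weightSum_smul {i : ℤ} {c : k} {v : V.carrier} (hv : g hn hq • v = c • v) :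
    weightSum hn hq i • v = (∑ t ∈ Finset.range n, (q ^ (-i) * c) ^ t) • v := by
  rw [weightSum, Finset.sum_smul, Finset.sum_smul]
  refine Finset.sum_congr rfl fun t _ => ?_
  rw [smul_assoc, g_pow_smul hv, smul_smul, mul_pow]

theorem weightSum_smul_self {i : ℤ} {v : V.carrier} (hv : g hn hq • v = q ^ i • v) :
    weightSum hn hq i • v = (n : k) • v := by
  have h0 : q ≠ 0 := hq.ne_zero (by omega)
  rw [weightSum_smul hv, ← zpow_add₀ h0, neg_add_cancel, zpow_zero]
  simp

theorem weightSum_smul_eq_zero {i j : ℤ} {v : V.carrier} (hv : g hn hq • v = q ^ j • v)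
    (hij : ¬ (n : ℤ) ∣ j - i) : weightSum hn hq i • v = 0 := by
  have h0 : q ≠ 0 := hq.ne_zero (by omega)
  have h1 : q ^ (-i) * q ^ j ≠ 1 := by
    rw [← zpow_add₀ h0, neg_add_eq_sub]
    exact fun h => hij ((hq.zpow_eq_one_iff_dvd _).1 h)
  have h2 := geom_sum_mul (q ^ (-i) * q ^ j) n
  rw [mul_pow, zpow_pow_eq_one hq, zpow_pow_eq_one hq, mul_one, sub_self] at h2
  rw [weightSum_smul hv, (mul_eq_zero.1 h2).resolve_right (sub_ne_zero.2 h1), zero_smul]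

end WeightSum

/-! ### Every module is a sum of modules $M(l,i)$ -/

section Classification

variable {hn hq}

/-- A nonzero module maps onto some `M(l, i)` with a section. -/
theorem exists_split (V : FDModule k (TaftAlgebra hn hq)) (hV : Module.finrank k V.carrier ≠ 0) :
    ∃ (l : ℕ) (hl : l ≤ n) (i : ℤ)
      (s : (indecModule hn hq l hl i).carrier →ₗ[TaftAlgebra hn hq] V.carrier)
      (p : V.carrier →ₗ[TaftAlgebra hn hq] (indecModule hn hq l hl i).carrier),
      l ≠ 0 ∧ p ∘ₗ s = LinearMap.id := by
  classical
  have h0 : q ≠ 0 := hq.ne_zero (by omega)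
  have hn0 := natCast_ne_zero hn hq
  -- The length $l$ of the summand is the nilpotency index of $h$ on $V$: a chain of maximal length
  -- splits off.
  obtain ⟨l, hl, hmin⟩ : ∃ l, (∀ v : V.carrier, h hn hq ^ l • v = 0) ∧
      ∀ m < l, ¬ ∀ v : V.carrier, h hn hq ^ m • v = 0 := by
    have hex : ∃ l, ∀ v : V.carrier, h hn hq ^ l • v = 0 := ⟨n, by simp [h_pow]⟩
    exact ⟨Nat.find hex, Nat.find_spec hex, fun m hm => Nat.find_min hex hm⟩
  have hln : l ≤ n := by
    by_contra hc
    exact hmin n (by omega) (by simp [h_pow])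
  have hl0 : l ≠ 0 := by
    rintro rfl
    refine hV ?_
    have : Subsingleton V.carrier := ⟨fun x y => by
      have hx := hl x
      have hy := hl y
      rw [pow_zero, one_smul] at hx hy
      rw [hx, hy]⟩
    exact Module.finrank_zero_of_subsingleton
  obtain ⟨m, rfl⟩ := Nat.exists_eq_succ_of_ne_zero hl0
  -- Every vector is, up to the unit $n$, a sum of weight vectors, so if $h^m$ killed them all it
  -- would be zero on $V$.
  obtain ⟨i, v, hv, hu⟩ : ∃ (i : ℤ) (v : V.carrier),
      g hn hq • v = q ^ i • v ∧ h hn hq ^ m • v ≠ 0 := by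
    by_contra! hc
    refine hmin m (by omega) fun x => ?_
    have h1 : (n : k) • x = ∑ i ∈ Finset.range n, weightSum hn hq i • x := by
      rw [← Finset.sum_smul, sum_weightSum, smul_assoc, one_smul]
    rw [← smul_eq_zero_iff_right hn0, smul_comm, h1, Finset.smul_sum]
    refine Finset.sum_eq_zero fun i _ => hc i _ ?_
    rw [← mul_smul, g_mul_weightSum, smul_assoc]
  set e : ℤ := i - m with he
  -- A functional supported on the weight $e$ of the end $h^m v$ of the chain: compose one that is
  -- nonzero there with the eigenprojection and rescale.
  obtain ⟨f, hf⟩ : ∃ f : V.carrier →ₗ[k] k, (∀ x, f (g hn hq • x) = q ^ e * f x) ∧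
      f (h hn hq ^ m • v) = 1 := by
    obtain ⟨f₀, hf₀⟩ := Module.Projective.exists_dual_ne_zero k hu
    refine ⟨((n : k) * f₀ (h hn hq ^ m • v))⁻¹ • f₀ ∘ₗ V.action (weightSum hn hq e),
      fun x => ?_, ?_⟩
    · change _ * f₀ (weightSum hn hq e • g hn hq • x) = q ^ e * (_ * f₀ (weightSum hn hq e • x))
      have h1 : weightSum hn hq e * g hn hq = g hn hq * weightSum hn hq e := by
        rw [weightSum, Finset.sum_mul, Finset.mul_sum]
        refine Finset.sum_congr rfl fun t _ => ?_
        rw [mul_smul_comm, smul_mul_assoc, ← pow_succ, ← pow_succ']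
      rw [← mul_smul, h1, g_mul_weightSum, smul_assoc, LinearMap.map_smul, smul_eq_mul, mul_left_comm]
    · change _ * f₀ (weightSum hn hq e • h hn hq ^ m • v) = 1
      rw [weightSum_smul_self (g_smul_h_pow_smul hv m), LinearMap.map_smul, smul_eq_mul,
        inv_mul_cancel₀ (mul_ne_zero hn0 hf₀)]
  obtain ⟨hfg, hf1⟩ := hf
  -- The weights of $h^t v$ and $h^m v$ differ by $q^{m-t}\ne1$, because $0<m-t<n$.
  have hf0 (t : ℕ) (ht : t < m) : f (h hn hq ^ t • v) = 0 := by
    have h1 := hfg (h hn hq ^ t • v)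
    rw [g_smul_h_pow_smul hv, map_smul, smul_eq_mul, ← sub_eq_zero, ← sub_mul] at h1
    refine (mul_eq_zero.1 h1).resolve_left fun h2 => ?_
    have h3 : q ^ (m - t) = 1 := by
      have : q ^ ((m - t : ℕ) : ℤ) * q ^ e = q ^ e := by
        rw [← zpow_add₀ h0]
        refine (congrArg (q ^ ·) ?_).trans (sub_eq_zero.1 h2)
        push_cast [ht.le]
        omega
      rw [← zpow_natCast]
      exact mul_right_cancel₀ (zpow_ne_zero e h0) (this.trans (one_mul _).symm)
    exact hq.pow_ne_one_of_pos_of_lt (by omega) (by omega) h3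
  -- The coordinate $f(h^{m-j}x)$ makes $h$ shift coordinates as it does on $M(m+1,i)$;
  -- compatibility in coordinate $0$ uses $h^{m+1}=0$ on $V$.
  let p₀ : V.carrier →ₗ[k] (indecModule hn hq (m + 1) hln i).carrier :=
    LinearMap.pi fun j : Fin (m + 1) => f ∘ₗ V.action (h hn hq ^ (m - (j : ℕ)))
  have hp₀ (x : V.carrier) : p₀ x = fun j : Fin (m + 1) => f (h hn hq ^ (m - (j : ℕ)) • x) := rfl
  let p : V.carrier →ₗ[TaftAlgebra hn hq] (indecModule hn hq (m + 1) hln i).carrier :=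
    linearMapOfGens p₀ (fun x => by
      rw [g_smul_indec, hp₀, hp₀]
      funext j
      rw [gMatrix, Matrix.mulVec_diagonal, ← mul_smul, h_pow_mul_g, smul_assoc, map_smul,
        mul_smul, hfg, smul_eq_mul, ← mul_assoc, ← zpow_natCast, ← zpow_add₀ h0]
      congr 2
      have := j.2
      push_cast [Nat.le_of_lt_succ j.2]
      omega) (fun x => by
      rw [h_smul_indec, hp₀, hp₀]
      funext j
      rw [← mul_smul, ← pow_succ, Matrix.mulVec, dotProduct]
      rcases j with ⟨_ | j, hj⟩
      · rw [Finset.sum_eq_zero fun c _ => by simp [hMatrix]]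
        simp [hl]
      · rw [Finset.sum_eq_single_of_mem ⟨j, by omega⟩ (Finset.mem_univ _)]
        · simp [hMatrix, show m - (j + 1) + 1 = m - j by omega]
        · intro c _ hc
          have : ¬ j = (c : ℕ) := fun h => hc (Fin.ext h.symm)
          simp [hMatrix, this])
  obtain ⟨s, hs⟩ := exists_hom_of_weight (m + 1) hln i v hv (hl v)
  have hps : p (s (vec hn hq (m + 1) hln i 0)) = vec hn hq (m + 1) hln i 0 := by
    rw [hs, pow_zero, one_smul, vec_of_lt (by omega)]
    funext j
    change f (h hn hq ^ (m - (j : ℕ)) • v) = _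
    rcases j with ⟨_ | j, hj⟩
    · simpa using hf1
    · rw [hf0 _ (by simp; omega)]
      simp
  refine ⟨m + 1, hln, i, s, p, hl0, ?_⟩
  refine LinearMap.restrictScalars_injective k (LinearMap.ext_on span_vec ?_)
  rintro _ ⟨r, rfl⟩
  change p (s _) = _
  rw [← zero_add r, ← h_pow_smul_vec, map_smul, map_smul, hps]
  rfl

/-- The Green ring is generated, as a group, by the classes `[M(l, i)]`. -/
theorem greenClass_mem (N : AddSubgroup (GreenRing k (TaftAlgebra hn hq)))
    (hN : ∀ (l : ℕ) (hl : l ≤ n) (i : ℤ), l ≠ 0 → (indecModule hn hq l hl i).greenClass ∈ N)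
    (x : GreenRing k (TaftAlgebra hn hq)) : x ∈ N := by
  induction x using GreenRing.induction with
  | zero => exact N.zero_mem
  | add x y hx hy => exact N.add_mem hx hy
  | neg x hx => exact N.neg_mem hx
  | of V =>
    induction hd : Module.finrank k V.carrier using Nat.strong_induction_on generalizing V with
    | _ d ih =>
    rcases eq_or_ne d 0 with rfl | hd0
    · rw [FDModule.greenClass_eq_zero_of_finrank hd]
      exact N.zero_mem
    obtain ⟨l, hl, i, s, p, hl0, hps⟩ := exists_split V (hd ▸ hd0)
    have h1 := FDModule.equiv_directSum_ker p s hps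
    have h2 : Module.finrank k V.carrier =
        Module.finrank k (indecModule hn hq l hl i).carrier +
          Module.finrank k (FDModule.ker p).carrier := by
      obtain ⟨e⟩ := h1
      exact (FDModule.baseEquiv e).finrank_eq.trans Module.finrank_prod
    rw [finrank_indecModule] at h2
    rw [FDModule.greenClass_congr h1, FDModule.greenClass_directSum]
    exact N.add_mem (hN l hl i hl0) (ih _ (by omega) _ rfl)

end Classification

/-! ### Multiplicities from ranks, and linear independence -/

section Multiplicity

variable {hn hq} {l : ℕ} {hl : l ≤ n} {i : ℤ}

/-- As $l\le n$, the weights in $M(l,j)$ are distinct, and only the basis vector of index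
$r=(j-i)\bmod n$ can have weight $q^i$. Then $h^m$ moves it to index $r+m$, which is nonzero exactly
when $r+m<l$. -/
theorem rank_indecModule (m : ℕ) (i j : ℤ) :
    (indecModule hn hq l hl j).rank (h hn hq ^ m * weightSum hn hq i) =
      if (j - i) % n + m < l then 1 else 0 := by
  have hn0 := natCast_ne_zero hn hq
  obtain ⟨r, hr⟩ : ∃ r : ℕ, (r : ℤ) = (j - i) % n :=
    ⟨((j - i) % n).toNat, Int.toNat_of_nonneg (Int.emod_nonneg _ (by omega))⟩
  have hrn : (r : ℤ) < n := hr ▸ Int.emod_lt_of_pos _ (by omega)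
  have hdvd (s : ℕ) : (n : ℤ) ∣ j - s - i ↔ (n : ℤ) ∣ r - s := by
    rw [hr, sub_right_comm, Int.dvd_iff_emod_eq_zero, Int.dvd_iff_emod_eq_zero, Int.emod_sub_emod]
  have hsame : h hn hq ^ m • weightSum hn hq i • vec hn hq l hl j r =
      (n : k) • vec hn hq l hl j (r + m) := by
    rw [weightSum_smul_self, smul_comm, h_pow_smul_vec]
    obtain ⟨c, hc⟩ := (hdvd r).2 (by simp)
    rw [g_smul_vec, show j - r = i + n * c by omega, zpow_add₀ (hq.ne_zero (by omega)),
      zpow_mul, zpow_natCast, hq.pow_eq_one, one_zpow, mul_one]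
  have hrange : LinearMap.range ((indecModule hn hq l hl j).action
      (h hn hq ^ m * weightSum hn hq i)) = Submodule.span k {vec hn hq l hl j (r + m)} := by
    refine le_antisymm ?_ ?_
    · rw [← Submodule.map_top, ← span_vec, Submodule.map_span, Submodule.span_le]
      rintro _ ⟨_, ⟨s, rfl⟩, rfl⟩
      change (h hn hq ^ m * weightSum hn hq i) • vec hn hq l hl j s ∈ _
      rw [mul_smul]
      by_cases hs : s < l
      · rcases eq_or_ne s r with rfl | hsr
        · rw [hsame]
          exact Submodule.smul_mem _ _ (Submodule.mem_span_singleton_self _)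
        · rw [weightSum_smul_eq_zero (g_smul_vec s), smul_zero]
          · exact Submodule.zero_mem _
          · rw [hdvd]
            intro hd
            have := Int.eq_zero_of_abs_lt_dvd hd (by rw [abs_lt]; omega)
            omega
      · rw [vec_of_le (s := s) (by omega), smul_zero, smul_zero]
        exact Submodule.zero_mem _
    · rw [Submodule.span_singleton_le_iff_mem]
      refine ⟨(n : k)⁻¹ • vec hn hq l hl j r, ?_⟩
      change (h hn hq ^ m * weightSum hn hq i) • (n : k)⁻¹ • vec hn hq l hl j r = _
      rw [smul_comm, mul_smul, hsame, inv_smul_smul₀ hn0]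
  rw [FDModule.rank, hrange, ← hr]
  split_ifs with hlt
  · exact finrank_span_singleton (mt vec_eq_zero_iff.1 (by omega))
  · rw [vec_of_le (by omega), Submodule.span_zero_singleton, finrank_bot]

/-- The number of summands `M(l, i)` with `m < l` of a module, as a function on the Green ring. -/
noncomputable def tailMult (hn : 2 ≤ n) (hq : IsPrimitiveRoot q n) (m : ℕ) (i : ℤ) :
    GreenRing k (TaftAlgebra hn hq) →+ ℤ :=
  GreenRing.rankHom (h hn hq ^ m * weightSum hn hq i) -
    GreenRing.rankHom (h hn hq ^ (m + 1) * weightSum hn hq (i + 1))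

/-- Put $r=(j-i)\bmod n$. For $r>0$, passing to $(m+1,i+1)$ replaces $r+m$ by $(r-1)+(m+1)$, and the
two ranks cancel. For $r=0$ the residue wraps to $n-1$, so the second rank is $0$ and the first
remains. -/
theorem tailMult_indecModule (m : ℕ) (i j : ℤ) :
    tailMult hn hq m i (indecModule hn hq l hl j).greenClass =
      if (n : ℤ) ∣ j - i ∧ m < l then 1 else 0 := by
  rw [tailMult, AddMonoidHom.sub_apply, GreenRing.rankHom_greenClass, GreenRing.rankHom_greenClass,
    rank_indecModule, rank_indecModule]
  simp only [Int.dvd_iff_emod_eq_zero]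
  have hpos : (0 : ℤ) < n := by omega
  have h1 := Int.emod_nonneg (j - i) hpos.ne'
  have h2 := Int.emod_lt_of_pos (j - i) hpos
  have h3 := Int.emod_nonneg (j - (i + 1)) hpos.ne'
  have h4 := Int.emod_lt_of_pos (j - (i + 1)) hpos
  have h5 : (j - (i + 1)) % n = ((j - i) % n - 1) % n := by
    rw [Int.emod_sub_emod, sub_sub]
  by_cases h0 : (j - i) % n = 0
  · have h6 : (j - (i + 1)) % n = n - 1 := by
      rw [h5, h0, zero_sub, ← Int.add_emod_right (-1), Int.emod_eq_of_lt (by omega) (by omega)]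
      omega
    rw [h0, h6]
    split_ifs <;> first | rfl | omega
  · have h6 : (j - (i + 1)) % n = (j - i) % n - 1 := by
      rw [h5, Int.emod_eq_of_lt (a := (j - i) % n - 1) (by omega) (by omega)]
    rw [h6]
    split_ifs <;> first | rfl | omega

theorem linearIndependent_indecModule (c : Fin n × Fin n → ℤ)
    (hc : ∑ p, c p • (indecModule hn hq (p.2 + 1) p.2.2 (-(p.1 : ℕ))).greenClass = 0) :
    c = 0 := by
  have htail (m : ℕ) (a : Fin n) :
      ∑ b : Fin n, (if m < (b : ℕ) + 1 then c (a, b) else 0) = 0 := by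
    have h1 := congrArg (tailMult hn hq m (-(a : ℕ))) hc
    rw [map_zero, map_sum, Fintype.sum_prod_type, Finset.sum_eq_single_of_mem a (Finset.mem_univ _)]
      at h1
    · refine Eq.trans ?_ h1
      refine Finset.sum_congr rfl fun b _ => ?_
      rw [map_zsmul, tailMult_indecModule]
      simp
    · intro b _ hb
      refine Finset.sum_eq_zero fun b' _ => ?_
      rw [map_zsmul, tailMult_indecModule, if_neg, smul_zero]
      rintro ⟨hd, -⟩
      have : -((b : ℕ) : ℤ) - -((a : ℕ) : ℤ) = 0 :=
        Int.eq_zero_of_abs_lt_dvd hd (by rw [abs_lt]; omega)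
      exact hb (Fin.ext (by omega))
  funext ⟨a, b⟩
  -- The tails starting at $b$ and at $b+1$ differ exactly in the coefficient $c(a,b)$.
  have h1 := htail b a
  have h2 := htail (b + 1) a
  rw [← h2, ← sub_eq_zero, ← Finset.sum_sub_distrib,
    Finset.sum_eq_single_of_mem b (Finset.mem_univ _)] at h1
  · simpa using h1
  · intro b' _ hb'
    have : (b' : ℕ) ≠ b := fun h => hb' (Fin.ext h)
    split_ifs <;> omega

end Multiplicity

end TaftAlgebra

/-! ### Generators of $\mathbb Z[y,z]/I$ as a group -/

section Polynomial

open MvPolynomial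

/-- The ring homomorphism out of `ℤ[y, z]` given by two commuting elements. -/
theorem exists_ringHom_of_commute {R : Type*} [Ring R] {a b : R} (hab : a * b = b * a) :
    ∃ φ : MvPolynomial (Fin 2) ℤ →+* R, φ (X 0) = a ∧ φ (X 1) = b := by
  -- Evaluation of polynomials needs a commutative target, and $R$ need not be commutative; the
  -- subring generated by two commuting elements is.
  let s : Set R := {a, b}
  have : IsMulCommutative (Algebra.adjoin ℤ s) := Algebra.isMulCommutative_adjoin ℤ (by
    rintro _ (rfl | rfl) _ (rfl | rfl) <;> first | rfl | exact hab | exact hab.symm)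
  let _ : CommRing (Algebra.adjoin ℤ s) := { mul_comm := this.is_comm.comm }
  let a' : Algebra.adjoin ℤ s := ⟨a, Algebra.subset_adjoin (Or.inl rfl)⟩
  let b' : Algebra.adjoin ℤ s := ⟨b, Algebra.subset_adjoin (Or.inr rfl)⟩
  let ψ : Algebra.adjoin ℤ s →+* R := (Algebra.adjoin ℤ s).val.toRingHom
  refine ⟨ψ.comp (eval₂Hom (Int.castRingHom _) ![a', b']), ?_, ?_⟩
  · rw [RingHom.comp_apply, eval₂Hom_X']
    rfl
  · rw [RingHom.comp_apply, eval₂Hom_X']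
    rfl

/-- The span contains $1$ and is stable under $y$, by $y^n=1$, and under $z$, by the recursion in
the form $zf_l=f_{l+1}+yf_{l-1}$, replaced at $l=n$ by $zf_n=f_n+yf_n$. -/
theorem span_monomial_mul_genFib {n : ℕ} (hn : 2 ≤ n) :
    Submodule.span ℤ (Set.range fun p : Fin n × Fin n =>
      Ideal.Quotient.mk (fibIdeal n) (X 0 ^ (p.1 : ℕ) * genFib (p.2 + 1))) = ⊤ := by
  set Q := MvPolynomial (Fin 2) ℤ ⧸ fibIdeal n
  set y : Q := Ideal.Quotient.mk (fibIdeal n) (X 0) with hy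
  set z : Q := Ideal.Quotient.mk (fibIdeal n) (X 1) with hz
  set N := Submodule.span ℤ (Set.range fun p : Fin n × Fin n =>
    Ideal.Quotient.mk (fibIdeal n) (X 0 ^ (p.1 : ℕ) * genFib (p.2 + 1))) with hN
  let F (l : ℕ) : Q := Ideal.Quotient.mk (fibIdeal n) (genFib l)
  have hF (l : ℕ) : F (l + 2) = z * F (l + 1) - y * F l := by
    simp only [F, hy, hz, ← map_mul, ← map_sub]
    rfl
  have hyn : y ^ n = 1 := by
    have h1 : Ideal.Quotient.mk (fibIdeal n) (X 0 ^ n - 1) = 0 :=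
      Ideal.Quotient.eq_zero_iff_mem.2 (Ideal.subset_span (Or.inl rfl))
    rwa [map_sub, map_pow, map_one, sub_eq_zero] at h1
  have hzn : z * F n = F n + y * F n := by
    have h1 : Ideal.Quotient.mk (fibIdeal n) ((X 1 - X 0 - 1) * genFib n) = 0 :=
      Ideal.Quotient.eq_zero_iff_mem.2 (Ideal.subset_span (Or.inr rfl))
    rw [map_mul, map_sub, map_sub, map_one] at h1
    linear_combination h1
  -- Arbitrary exponents $a$ and the value $l=0$, where $f_0=0$, are allowed so that the recursion
  -- needs no case at the lower end.
  have hmem (a l : ℕ) (hl : l ≤ n) : y ^ a * F l ∈ N := by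
    rcases l with _ | l
    · have : F 0 = 0 := map_zero _
      rw [this, mul_zero]
      exact N.zero_mem
    · refine Submodule.subset_span ⟨(⟨a % n, Nat.mod_lt _ (by omega)⟩, ⟨l, hl⟩), ?_⟩
      rw [pow_eq_pow_mod a hyn]
      exact map_mul _ _ _ |>.trans (congrArg (· * _) (map_pow _ _ _))
  have hmul (t : Q) (ht : ∀ a l, l < n → t * (y ^ a * F (l + 1)) ∈ N) (x : Q) (hx : x ∈ N) :
      t * x ∈ N := by
    induction hx using Submodule.span_induction with
    | mem x hx =>
      obtain ⟨p, rfl⟩ := hx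
      have := ht p.1 p.2 p.2.2
      simpa only [map_mul, map_pow] using this
    | zero => rw [mul_zero]; exact N.zero_mem
    | add x x' _ _ hx hx' => rw [mul_add]; exact N.add_mem hx hx'
    | smul c x _ hx => rw [mul_smul_comm]; exact N.smul_mem c hx
  have hymul := hmul y fun a l hl => by
    rw [← mul_assoc, ← pow_succ']
    exact hmem _ _ hl
  have hzmul := hmul z fun a l hl => by
    rcases Nat.lt_or_ge (l + 1) n with h1 | h1
    · have : z * (y ^ a * F (l + 1)) = y ^ a * F (l + 2) + y ^ (a + 1) * F l := by
        rw [hF]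
        ring
      rw [this]
      exact N.add_mem (hmem _ _ h1) (hmem _ _ hl.le)
    · obtain rfl : l + 1 = n := by omega
      have : z * (y ^ a * F (l + 1)) = y ^ a * F (l + 1) + y ^ (a + 1) * F (l + 1) := by
        linear_combination y ^ a * hzn
      rw [this]
      exact N.add_mem (hmem _ _ le_rfl) (hmem _ _ le_rfl)
  refine eq_top_iff.2 fun x hx => ?_
  clear hx
  obtain ⟨x, rfl⟩ := Ideal.Quotient.mk_surjective x
  have h1 : (1 : Q) ∈ N := by
    have := hmem 0 1 (by omega)
    rwa [pow_zero, one_mul, show F 1 = 1 from map_one _] at this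
  induction x using MvPolynomial.induction_on with
  | C c =>
    have := N.smul_mem c h1
    rw [zsmul_one] at this
    exact (congrArg (· ∈ N) (map_intCast ((Ideal.Quotient.mk (fibIdeal n)).comp C) c)).mpr this
  | add p p' hp hp' => rw [map_add]; exact N.add_mem hp hp'
  | mul_X p r hp =>
    rw [map_mul, mul_comm]
    fin_cases r
    · exact hymul _ hp
    · exact hzmul _ hp

end Polynomial

/-! ### The isomorphism -/

theorem mainTheorem1 {k : Type u} [Field k] {n : ℕ} (hn : 2 ≤ n) {q : k}
    (hq : IsPrimitiveRoot q n) :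
    ∃ φ : (MvPolynomial (Fin 2) ℤ ⧸ fibIdeal n) ≃+* GreenRing k (TaftAlgebra hn hq),
      φ (Ideal.Quotient.mk (fibIdeal n) (MvPolynomial.X 0)) =
          (TaftAlgebra.simpleModule hn hq (-1)).greenClass ∧
        φ (Ideal.Quotient.mk (fibIdeal n) (MvPolynomial.X 1)) =
          (TaftAlgebra.indecModule hn hq 2 hn 0).greenClass := by
  obtain ⟨ψ, hy, hz⟩ := exists_ringHom_of_commute
    (a := (TaftAlgebra.simpleModule hn hq (-1)).greenClass)
    (b := (TaftAlgebra.indecModule hn hq 2 hn 0).greenClass)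
    (by rw [TaftAlgebra.simpleModule_mul, TaftAlgebra.mul_simpleModule])
  have hpow (a l : ℕ) (hl : l ≤ n) : ψ (MvPolynomial.X 0 ^ a) *
      (TaftAlgebra.indecModule hn hq l hl 0).greenClass =
        (TaftAlgebra.indecModule hn hq l hl (-(a : ℤ))).greenClass := by
    induction a with
    | zero => rw [pow_zero, map_one, one_mul, Nat.cast_zero, neg_zero]
    | succ a ih =>
      rw [pow_succ', map_mul, mul_assoc, ih, hy, TaftAlgebra.simpleModule_mul, Nat.cast_succ,
        neg_add]
  have hfib (l : ℕ) (hl : l ≤ n) :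
      ψ (genFib l) = (TaftAlgebra.indecModule hn hq l hl 0).greenClass := by
    induction l using Nat.strong_induction_on with
    | _ l ih =>
    match l with
    | 0 => exact (map_zero ψ).trans (TaftAlgebra.greenClass_indec_zero _ _).symm
    | 1 => exact (map_one ψ).trans (TaftAlgebra.greenClass_indec_one hl).symm
    | m + 2 =>
      have h1 : ψ (genFib (m + 2)) = ψ (MvPolynomial.X 1) * ψ (genFib (m + 1)) -
          ψ (MvPolynomial.X 0) * ψ (genFib m) := by
        rw [← map_mul, ← map_mul, ← map_sub]
        rfl
      rw [h1, ih (m + 1) (by omega) (by omega), ih m (by omega) (by omega), hy, hz,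
        TaftAlgebra.two_mul_of_lt hl (by omega) (by omega), TaftAlgebra.simpleModule_mul, zero_add,
        add_sub_cancel_right]
  have hper {i j : ℤ} (l : ℕ) (hl : l ≤ n) (hij : (n : ℤ) ∣ i - j) :
      (TaftAlgebra.indecModule hn hq l hl i).greenClass =
        (TaftAlgebra.indecModule hn hq l hl j).greenClass := by
    refine TaftAlgebra.greenClass_indec_congr hl ?_
    have h0 : q ≠ 0 := hq.ne_zero (by omega)
    rw [← sub_add_cancel i j, zpow_add₀ h0, (hq.zpow_eq_one_iff_dvd _).2 hij, one_mul]
  have hker (x) (hx : x ∈ fibIdeal n) : ψ x = 0 := by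
    suffices fibIdeal n ≤ RingHom.ker ψ from this hx
    refine Ideal.span_le.2 ?_
    rintro _ (rfl | rfl)
    -- Taking $l=1$, where $[M(1,0)]=1$, turns the action of $y^n$ on classes into its value:
    -- $\psi(y^n)=[M(1,-n)]=[M(1,0)]=1$.
    · have h1 := hpow n 1 (by omega)
      rw [hper (i := -(n : ℤ)) (j := 0) 1 _ (by simp), TaftAlgebra.greenClass_indec_one, mul_one] at h1
      change ψ _ = 0
      rw [map_sub, h1, map_one, sub_self]
    · change ψ _ = 0
      rw [map_mul, map_sub, map_sub, map_one, hfib n le_rfl, hy, hz, sub_mul, sub_mul,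
        TaftAlgebra.two_mul_self, TaftAlgebra.simpleModule_mul, one_mul, zero_add,
        add_sub_cancel_right, sub_self]
  let φ : (MvPolynomial (Fin 2) ℤ ⧸ fibIdeal n) →+* GreenRing k (TaftAlgebra hn hq) :=
    Ideal.Quotient.lift (fibIdeal n) ψ hker
  have hφ (x) : φ (Ideal.Quotient.mk (fibIdeal n) x) = ψ x := Ideal.Quotient.lift_mk _ _ _
  have hbasis (a l : ℕ) (hl : l ≤ n) :
      φ (Ideal.Quotient.mk (fibIdeal n) (MvPolynomial.X 0 ^ a * genFib l)) =
        (TaftAlgebra.indecModule hn hq l hl (-(a : ℤ))).greenClass := by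
    rw [hφ, map_mul, hfib l hl, hpow]
  refine ⟨RingEquiv.ofBijective φ ⟨(injective_iff_map_eq_zero φ).2 fun x hx => ?_, fun x => ?_⟩,
    (hφ _).trans hy, (hφ _).trans hz⟩
  -- Write $x$ in the spanning family; its image is the same combination of independent classes, so
  -- all coefficients vanish.
  · have h1 : x ∈ Submodule.span ℤ _ := span_monomial_mul_genFib hn ▸ Submodule.mem_top
    obtain ⟨c, rfl⟩ := (Submodule.mem_span_range_iff_exists_fun ℤ).1 h1
    rw [map_sum] at hx
    have hc : c = 0 := TaftAlgebra.linearIndependent_indecModule (hn := hn) (hq := hq) c (by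
      rw [← hx]
      refine Finset.sum_congr rfl fun p _ => ?_
      rw [map_zsmul, hbasis _ _ p.2.2])
    simp [hc]
  -- The range is a subgroup, so it suffices to reach each $[M(l,i)]$; the exponent of $y$ is the
  -- residue of $-i$ because $y$ lowers $i$.
  · refine TaftAlgebra.greenClass_mem φ.range.toAddSubgroup (fun l hl i _ => ?_) x
    refine ⟨Ideal.Quotient.mk (fibIdeal n)
      (MvPolynomial.X 0 ^ ((-i) % n).toNat * genFib l), (hbasis _ _ hl).trans (hper l hl ?_)⟩
    rw [Int.toNat_of_nonneg (Int.emod_nonneg _ (by omega))]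
    convert Int.dvd_self_sub_emod (x := -i) (m := n) using 1
    ring
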